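/- A commutative grammar over a finite alphabet $\Sigma$ is a tuple $G=(\Sigma,S,s_0,\delta)$ with a finite set $S$ of states, an initial state $s_0\in S$ and a set $\delta$ of transitions $\tau=(s,a,t)$, where $s=\mathrm{source}(\tau)\in S$, $a=\mathrm{out}(\tau)\in\mathbb N^\Sigma$, $t=\mathrm{target}(\tau)\in\mathbb N^S$; it is assumed that every state is the source of some transition, and that $|a|\le 1$ and $|t|\le 2$ for each transition (where $|\cdot|$ is the sum of the entries). $G$ is regular if $|t|\le 1$ for each transition. For a multiset $D\in\mathbb N^\delta$ of transitions, put $\mathrm{source}(D)=\sum_\tau D(\tau)\{\mathrm{source}(\tau)\}$, $\mathrm{target}(D)=\sum_\tau D(\tau)\,\mathrm{target}(\tau)$ and $\mathrm{out}(D)=\sum_\tau D(\tau)\,\mathrm{out}(\tau)$. $D$ is a run of $G$ if $\mathrm{source}(D)=\mathrm{target}(D)+\{s_0\}$ and every state occurring in $\mathrm{source}(D)$ is reachable from $s_0$ by a (possibly empty) path of transitions occurring in $D$. The Parikh image of $G$ is $\mathrm{out}(G)=\{\mathrm{out}(D): D\text{ is a run of }G\}\subseteq\mathbb N^\Sigma$.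 **Theorem.** For every fixed $d\in\mathbb N$, the following problem is decidable in polynomial time: given two regular commutative grammars $G$ and $H$ over the alphabet $\Sigma$ with $|\Sigma|=d$, decide whether $\mathrm{out}(G)\cap\mathrm{out}(H)=\emptyset$. That is, for each $d$ there are a Turing machine and a polynomial $p$ such that on each pair $(G,H)$, written as a word $w$ (the initial state and the list of transitions of each grammar, with states numbered in binary), the machine halts after at most $p(|w|)$ steps and outputs whether $\mathrm{out}(G)\cap\mathrm{out}(H)=\emptyset$. -/

import Mathlib

/-- A transition `s →ᵃ t` over letters `A` and states `S`: it consumes the state `source` and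
produces the multiset of letters `out` and the multiset of states `target`. -/
structure CommTransition (A S : Type) where
  source : S
  out : Multiset A
  target : Multiset S

/-- A commutative grammar with alphabet `A` and set of states `S` (the finiteness of `A` and `S`
is imposed where grammars are used). Every state is the source of some transition, and a
transition produces at most one letter and at most two states. -/
structure CommGrammar (A S : Type) where
  init : S
  transitions : Set (CommTransition A S)
  exists_source : ∀ s, ∃ τ ∈ transitions, τ.source = s
  card_out_le : ∀ τ ∈ transitions, τ.out.card ≤ 1
  card_target_le : ∀ τ ∈ transitions, τ.target.card ≤ 2

namespace CommGrammar

variable {A S : Type}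

/-- Regular commutative grammars: every transition produces at most one state. -/
def IsRegular (G : CommGrammar A S) : Prop :=
  ∀ τ ∈ G.transitions, τ.target.card ≤ 1

/-- How many times each state is the source of a transition in `D`. -/
def sourceOf (D : Multiset (CommTransition A S)) : Multiset S :=
  D.map CommTransition.source

/-- How many times each state is produced by `D`. -/
def targetOf (D : Multiset (CommTransition A S)) : Multiset S :=
  (D.map CommTransition.target).sum

/-- How many times each letter is produced by `D`. -/
def outOf (D : Multiset (CommTransition A S)) : Multiset A :=
  (D.map CommTransition.out).sum

/-- `D` is connected from `s`: each state in the support of `D` is reached from `s` by a path of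
transitions that occur in `D` (the empty path leads from `s` to `s`). -/
def ConnectedFrom (s : S) (D : Multiset (CommTransition A S)) : Prop :=
  ∀ t ∈ sourceOf D,
    Relation.ReflTransGen (fun p q => ∃ τ ∈ D, τ.source = p ∧ q ∈ τ.target) s t

/-- A run of `G`: a multiset of transitions of `G` that is connected from the initial state, and
in which each state is consumed as many times as it is produced, except for the initial state,
which is consumed one time more. -/
def IsRun (G : CommGrammar A S) (D : Multiset (CommTransition A S)) : Prop :=
  (∀ τ ∈ D, τ ∈ G.transitions) ∧ ConnectedFrom G.init D ∧ sourceOf D = targetOf D + {G.init}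

/-- The Parikh image `out(G)`: the set of outputs of runs of `G`. -/
def outputs (G : CommGrammar A S) : Set (Multiset A) :=
  {v | ∃ D, G.IsRun D ∧ outOf D = v}

end CommGrammar

/-- A regular commutative grammar over the alphabet `{0, …, d - 1}`, given as an input to an
algorithm: its states are numbered `0, …, n - 1`, and its transitions are listed in some order. -/
structure RegularGrammarInput (d : ℕ) where
  n : ℕ
  grammar : CommGrammar (Fin d) (Fin n)
  regular : grammar.IsRegular
  rules : List (CommTransition (Fin d) (Fin n))
  mem_rules : ∀ τ, τ ∈ rules ↔ τ ∈ grammar.transitions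

/-- The finite alphabet in which grammars over `{0, …, d - 1}` are written down. -/
inductive GrammarSymbol (d : ℕ)
  /-- a binary digit of the number of a state -/
  | bit (b : Bool)
  /-- a letter of the alphabet of the grammar -/
  | letter (a : Fin d)
  /-- opens the number of the initial state, and so the description of a grammar -/
  | start
  /-- opens a transition, and the number of its source -/
  | rule
  /-- opens the number of a state produced by the current transition -/
  | target

namespace GrammarSymbol

variable {d n : ℕ}

/-- The number of a state, in binary. -/
def writeState (s : Fin n) : List (GrammarSymbol d) :=
  (Computability.encodeNat s).map bit

/-- A transition: its source, the letters and then the states that it produces. -/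
def writeTransition (τ : CommTransition (Fin d) (Fin n)) : List (GrammarSymbol d) :=
  rule :: writeState τ.source ++ (τ.out.sort (· ≤ ·)).map letter ++
    (τ.target.sort (· ≤ ·)).flatMap (fun t => target :: writeState t)

/-- A grammar: its initial state, then the list of its transitions. -/
def writeGrammar (G : RegularGrammarInput d) : List (GrammarSymbol d) :=
  start :: writeState G.grammar.init ++ G.rules.flatMap writeTransition

/-- A pair of grammars, one after the other. -/
def writePair (P : RegularGrammarInput d × RegularGrammarInput d) : List (GrammarSymbol d) :=
  writeGrammar P.1 ++ writeGrammar P.2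

end GrammarSymbol

open Classical in
/-- The decision problem `p`, with inputs `x : α` written as words `enc x`, is in polynomial time:
some Turing machine (with several stacks) halts on each input `x` with the truth value of `p x` as
its output, after a number of steps polynomial in the length of `enc x`. -/
def DecidableInPolyTime {α Γ : Type} (enc : α → List Γ) (p : α → Prop) : Prop :=
  Nonempty (Turing.TM2ComputableInPolyTime enc Computability.encodeBool (fun x => decide (p x)))

/-! Adding an edge from the end back to the initial state turns a run of a regular grammar into a
connected balanced multiset of edges, that is, into an Eulerian circuit. Hence outputs of runs are
outputs of paths from the initial state to the end; `IsPath.mem_outputs` is the easy direction. More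
precisely, a balanced multiset is a sum of simple cycles (`exists_cycles`). Absorbing only those
cycles that contribute a new vertex yields a closed walk with at most N² edges that meets all
remaining cycles, where N bounds the number of vertices. So any subfamily of the remaining cycles
may be dropped and a path is still left (`exists_walk_cycles`, `exists_decomposition`).

Suppose two grammars share an output, decomposed as a + ∑ cᵢ on one side and b + ∑ eⱼ on the other.
Then the vectors a - b, cᵢ and -eⱼ have sum zero and entries of size at most N².
`ZeroSum.exists_subset` extracts a zero-sum subfamily that contains a - b and whose size, for fixed
d, is polynomial in N. Keeping only these cycles gives paths with equal outputs and polynomial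
length L (`exists_short_paths`).

Such paths are found by a reachability search in the product of the states with a counter. The
counter stores the output as a number in base L + 1, which loses nothing for at most L letters
(`value_injective`); for fixed d its range is polynomial. `meets_iff` states that the search is
correct.

For the running time, data are binary trees written in a prefix code on a stack, with numbers in
unary. `PolyTime` is closed under composition, pairing, case distinction and folds whose
intermediate values stay small (`PolyTime.foldl`), which suffices to express the algorithm.
`PolyTime.decidableInPolyTime` passes from such a function to a Turing machine. -/

/-! ### Structured programs for stack machines -/

namespace StackMachine

open Turing Function

/-- The working stacks of the machines below. -/
inductive Reg
  | main | a | b | c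
  deriving DecidableEq

instance : Fintype Reg := ⟨{.main, .a, .b, .c}, fun r => by cases r <;> simp⟩

/-- The alphabets of the stacks: the input stack `none` has alphabet `Γ₀`, the other ones hold
booleans. -/
abbrev Sym (Γ₀ : Type) : Option Reg → Type
  | none => Γ₀
  | some _ => Bool

/-- The internal memory of the machines: the symbols that were read last. -/
abbrev Mem (Γ₀ : Type) : Type := Option Bool × Option Γ₀

/-- The contents of all stacks, given those of the input stack and of the working stacks. -/
def contents {Γ₀ : Type} (i : List Γ₀) (S : Reg → List Bool) : ∀ k, List (Sym Γ₀ k)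
  | none => i
  | some r => S r

@[simp] theorem contents_none {Γ₀ : Type} (i : List Γ₀) (S : Reg → List Bool) :
    contents i S none = i := rfl

@[simp] theorem contents_some {Γ₀ : Type} (i : List Γ₀) (S : Reg → List Bool) (r : Reg) :
    contents i S (some r) = S r := rfl

theorem update_contents_some {Γ₀ : Type} (i : List Γ₀) (S : Reg → List Bool) (r : Reg)
    (l : List Bool) : update (contents i S) (some r) l = contents i (update S r l) := by
  funext k
  rcases k with _ | k
  · simp [update]
  · by_cases h : k = r
    · subst h; simp
    · simp [h]

theorem update_contents_none {Γ₀ : Type} (i : List Γ₀) (S : Reg → List Bool) (l : List Γ₀) :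
    update (contents i S) none l = contents l S := by
  funext k
  rcases k with _ | k
  · simp
  · simp [update]

/-- The configuration `x` of the machine `M` leads to `y` in at most `t` steps. -/
def ReachesIn {Γ₀ Λ : Type} (M : Λ → TM2.Stmt (Sym Γ₀) Λ (Mem Γ₀))
    (x y : TM2.Cfg (Sym Γ₀) Λ (Mem Γ₀)) (t : ℕ) : Prop :=
  ∃ n ≤ t, (flip bind (TM2.step M))^[n] (some x) = some y

namespace ReachesIn

variable {Γ₀ Λ : Type} {M : Λ → TM2.Stmt (Sym Γ₀) Λ (Mem Γ₀)}
  {x y z : TM2.Cfg (Sym Γ₀) Λ (Mem Γ₀)} {s t : ℕ}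

theorem mono (h : ReachesIn M x y s) (hst : s ≤ t) : ReachesIn M x y t :=
  let ⟨n, hn, e⟩ := h
  ⟨n, hn.trans hst, e⟩

theorem trans (h₁ : ReachesIn M x y s) (h₂ : ReachesIn M y z t) : ReachesIn M x z (s + t) := by
  obtain ⟨n, hn, e⟩ := h₁
  obtain ⟨m, hm, e'⟩ := h₂
  exact ⟨m + n, by omega, by rw [iterate_add_apply, e, e']⟩

theorem single {l : Λ} {v : Mem Γ₀} {S : ∀ k, List (Sym Γ₀ k)}
    (h : TM2.stepAux (M l) v S = y) : ReachesIn M ⟨some l, v, S⟩ y 1 :=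
  ⟨1, le_rfl, by simp [flip, h]⟩

end ReachesIn

/-- A program with a single entry and a single exit. Its code can be placed into any machine, given
an embedding of its labels into those of the machine and the label at which the machine continues
afterwards. -/
structure Prog (Γ₀ : Type) where
  Label : Type
  fintypeLabel : Fintype Label
  entry : Label
  code : ∀ {Λ : Type}, (Label → Λ) → Λ → Label → TM2.Stmt (Sym Γ₀) Λ (Mem Γ₀)

/-- Started with contents `S` of the working stacks, the program `P` ends with `S'` after at most
`t` steps. -/
def Runs {Γ₀ : Type} (P : Prog Γ₀) (S S' : Reg → List Bool) (t : ℕ) : Prop :=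
  ∀ (Λ : Type) (M : Λ → TM2.Stmt (Sym Γ₀) Λ (Mem Γ₀)) (emb : P.Label → Λ) (exit : Λ),
    (∀ l, M (emb l) = P.code emb exit l) → ∀ i v, ∃ v',
      ReachesIn M ⟨some (emb P.entry), v, contents i S⟩ ⟨some exit, v', contents i S'⟩ t

namespace Prog

variable {Γ₀ : Type}

/-- The program that does nothing. -/
def skip : Prog Γ₀ where
  Label := Unit
  fintypeLabel := inferInstance
  entry := ()
  code _ exit _ := .goto fun _ => exit

/-- Push a symbol on a stack. -/
def push (r : Reg) (x : Bool) : Prog Γ₀ where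
  Label := Unit
  fintypeLabel := inferInstance
  entry := ()
  code _ exit _ := .push (some r) (fun _ => x) (.goto fun _ => exit)

/-- One program after the other. -/
def seq (P Q : Prog Γ₀) : Prog Γ₀ where
  Label := P.Label ⊕ Q.Label
  fintypeLabel := @instFintypeSum _ _ P.fintypeLabel Q.fintypeLabel
  entry := .inl P.entry
  code emb exit l :=
    match l with
    | .inl l => P.code (emb ∘ .inl) (emb (.inr Q.entry)) l
    | .inr l => Q.code (emb ∘ .inr) exit l

/-- Pop a symbol from a stack and continue accordingly. -/
def popCase (r : Reg) (P : Option Bool → Prog Γ₀) : Prog Γ₀ where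
  Label := Option (Σ o, (P o).Label)
  fintypeLabel :=
    haveI := fun o => (P o).fintypeLabel
    inferInstance
  entry := none
  code emb exit l :=
    match l with
    | none => .pop (some r) (fun v o => (o, v.2)) (.goto fun v => emb (some ⟨v.1, (P v.1).entry⟩))
    | some ⟨o, l⟩ => (P o).code (fun l => emb (some ⟨o, l⟩)) exit l

/-- Pop symbols from a stack and continue accordingly, until one of the cases in `exits` occurs. -/
def loop (r : Reg) (exits : Option Bool → Bool) (P : Option Bool → Prog Γ₀) : Prog Γ₀ where
  Label := Option (Σ o, (P o).Label)
  fintypeLabel :=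
    haveI := fun o => (P o).fintypeLabel
    inferInstance
  entry := none
  code emb exit l :=
    match l with
    | none => .pop (some r) (fun v o => (o, v.2))
        (.goto fun v => if exits v.1 then exit else emb (some ⟨v.1, (P v.1).entry⟩))
    | some ⟨o, l⟩ => (P o).code (fun l => emb (some ⟨o, l⟩)) (emb none) l

end Prog

namespace Runs

variable {Γ₀ : Type} {P Q : Prog Γ₀} {S S' S'' : Reg → List Bool} {s t : ℕ}

theorem mono (h : Runs P S S' s) (hst : s ≤ t) : Runs P S S' t := by
  intro Λ M emb exit hM i v
  obtain ⟨v', h'⟩ := h Λ M emb exit hM i v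
  exact ⟨v', h'.mono hst⟩

theorem skip : Runs (Γ₀ := Γ₀) Prog.skip S S 1 := by
  intro Λ M emb exit hM i v
  exact ⟨v, .single (by rw [hM]; simp [Prog.skip])⟩

theorem push (r : Reg) (x : Bool) :
    Runs (Γ₀ := Γ₀) (.push r x) S (update S r (x :: S r)) 1 := by
  intro Λ M emb exit hM i v
  exact ⟨v, .single (by rw [hM]; simp [Prog.push, update_contents_some])⟩

/-- Correctness is stated for every machine that contains the code, so both parts run inside the
machine of the composite, the exit of the first being the entry of the second. -/
theorem seq (h₁ : Runs P S S' s) (h₂ : Runs Q S' S'' t) : Runs (P.seq Q) S S'' (s + t) := by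
  intro Λ M emb exit hM i v
  obtain ⟨v', h₁'⟩ := h₁ Λ M (emb ∘ .inl) (emb (.inr Q.entry)) (fun l => hM (.inl l)) i v
  obtain ⟨v'', h₂'⟩ := h₂ Λ M (emb ∘ .inr) exit (fun l => hM (.inr l)) i v'
  exact ⟨v'', h₁'.trans h₂'⟩

theorem popCase {r : Reg} {P : Option Bool → Prog Γ₀}
    (h : Runs (P (S r).head?) (update S r (S r).tail) S' t) :
    Runs (.popCase r P) S S' (1 + t) := by
  intro Λ M emb exit hM i v
  obtain ⟨v', h'⟩ := h Λ M (fun l => emb (some ⟨(S r).head?, l⟩)) exit (fun l => hM (some ⟨_, l⟩)) i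
    ((S r).head?, v.2)
  refine ⟨v', .trans (.single ?_) h'⟩
  rw [hM]
  simp [Prog.popCase, update_contents_some]

/-- The symbol that ends the loop is consumed as well. This is harmless on an empty stack, and in
folds it removes the mark of the empty list. -/
theorem loop_stop {r : Reg} {exits : Option Bool → Bool} {P : Option Bool → Prog Γ₀}
    (hs : exits (S r).head? = true) :
    Runs (.loop r exits P) S (update S r (S r).tail) 1 := by
  intro Λ M emb exit hM i v
  refine ⟨((S r).head?, v.2), .single ?_⟩
  rw [hM]
  simp [Prog.loop, update_contents_some, hs]

theorem loop_step {r : Reg} {exits : Option Bool → Bool} {P : Option Bool → Prog Γ₀}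
    (hs : exits (S r).head? = false)
    (h : Runs (P (S r).head?) (update S r (S r).tail) S' s)
    (h' : Runs (.loop r exits P) S' S'' t) :
    Runs (.loop r exits P) S S'' (1 + s + t) := by
  intro Λ M emb exit hM i v
  obtain ⟨v', h₁⟩ := h Λ M (fun l => emb (some ⟨(S r).head?, l⟩)) (emb none)
    (fun l => hM (some ⟨_, l⟩)) i ((S r).head?, v.2)
  obtain ⟨v'', h₂⟩ := h' Λ M emb exit hM i v'
  refine ⟨v'', .trans (.trans (.single ?_) h₁) h₂⟩
  rw [hM]
  simp [Prog.loop, update_contents_some, hs]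

end Runs

/-- The contents of the working stacks, one after the other. -/
def regs (m a b c : List Bool) : Reg → List Bool
  | .main => m
  | .a => a
  | .b => b
  | .c => c

section regs

variable (m a b c l : List Bool)

@[simp] theorem regs_main : regs m a b c .main = m := rfl
@[simp] theorem regs_a : regs m a b c .a = a := rfl
@[simp] theorem regs_b : regs m a b c .b = b := rfl
@[simp] theorem regs_c : regs m a b c .c = c := rfl

@[simp] theorem update_regs_main : update (regs m a b c) .main l = regs l a b c := by
  funext r; cases r <;> simp [update]
@[simp] theorem update_regs_a : update (regs m a b c) .a l = regs m l b c := by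
  funext r; cases r <;> simp [update]
@[simp] theorem update_regs_b : update (regs m a b c) .b l = regs m a l c := by
  funext r; cases r <;> simp [update]
@[simp] theorem update_regs_c : update (regs m a b c) .c l = regs m a b l := by
  funext r; cases r <;> simp [update]

end regs

/-! ### Binary trees on stacks -/

/-- Binary trees, the common format of all data. -/
inductive Tree
  | nil
  | cons (x y : Tree)

namespace Tree

/-- The prefix code of a tree. -/
def code : Tree → List Bool
  | nil => [false]
  | cons x y => true :: (x.code ++ y.code)

/-- The first bit tells whether a tree branches, so a code shows by itself where it ends. This is
why trees can be stacked without separators. -/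
theorem code_append_inj : ∀ {x y : Tree} {l l' : List Bool}, x.code ++ l = y.code ++ l' →
    x = y ∧ l = l'
  | nil, nil, l, l', h => by simpa [code] using h
  | nil, cons _ _, l, l', h => by simp [code] at h
  | cons _ _, nil, l, l', h => by simp [code] at h
  | cons x x', cons y y', l, l', h => by
    simp only [code, List.cons_append, List.cons.injEq, true_and, List.append_assoc] at h
    obtain ⟨h₁, h⟩ := code_append_inj h
    obtain ⟨h₂, h⟩ := code_append_inj h
    exact ⟨by rw [h₁, h₂], h⟩

theorem code_injective : Injective code := fun x y h =>
  (code_append_inj (l := []) (l' := []) (by simpa using h)).1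

theorem one_le_length_code (x : Tree) : 1 ≤ x.code.length := by
  cases x <;> simp [code]

end Tree

open Prog

variable {Γ₀ : Type}

/-- Move as many trees, reversed, from the main stack to the stack `r` as the stack `c` is high. -/
def moveLoop (r : Reg) : Prog Γ₀ :=
  loop .c (fun o => o.isNone) fun _ =>
    popCase .main fun o => match o with
      | some true => (push r true).seq ((push .c true).seq (push .c true))
      | _ => push r false

/-- Move a tree, reversed, from the main stack to the stack `r`. -/
def moveTo (r : Reg) : Prog Γ₀ := (push .c true).seq (moveLoop r)

/-- Empty a stack. -/
def flush (r : Reg) : Prog Γ₀ := loop r (fun o => o.isNone) fun _ => skip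

/-- Move everything from the stack `r` to the stack `r'`. -/
def pour (r r' : Reg) : Prog Γ₀ := loop r (fun o => o.isNone) fun o => push r' (o == some true)

theorem Runs.push_main {m a b c : List Bool} (x : Bool) :
    Runs (Γ₀ := Γ₀) (.push .main x) (regs m a b c) (regs (x :: m) a b c) 1 := by
  simpa using Runs.push (S := regs m a b c) .main x

theorem Runs.push_a {m a b c : List Bool} (x : Bool) :
    Runs (Γ₀ := Γ₀) (.push .a x) (regs m a b c) (regs m (x :: a) b c) 1 := by
  simpa using Runs.push (S := regs m a b c) .a x

theorem Runs.push_b {m a b c : List Bool} (x : Bool) :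
    Runs (Γ₀ := Γ₀) (.push .b x) (regs m a b c) (regs m a (x :: b) c) 1 := by
  simpa using Runs.push (S := regs m a b c) .b x

theorem Runs.push_c {m a b c : List Bool} (x : Bool) :
    Runs (Γ₀ := Γ₀) (.push .c x) (regs m a b c) (regs m a b (x :: c)) 1 := by
  simpa using Runs.push (S := regs m a b c) .c x

/-- The height of the stack `c` counts the subtrees still to be moved: a leaf lowers it by one, a
branching replaces one subtree by two. The rest of the loop is taken as a hypothesis, so that the
induction can chain the two subtrees. Each symbol costs at most 5 steps: two pops and three pushes.
-/
theorem Runs.moveTo_a_loop (x : Tree) : ∀ (m a b c : List Bool) {S : Reg → List Bool} {t : ℕ},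
    Runs (Γ₀ := Γ₀) (moveLoop .a) (regs m (x.code.reverse ++ a) b c) S t →
    Runs (Γ₀ := Γ₀) (moveLoop .a) (regs (x.code ++ m) a b (true :: c)) S
      (5 * x.code.length + t) := by
  unfold moveLoop
  induction x with
  | nil =>
    intro m a b c S t h
    refine (Runs.loop_step (by simp) (s := 2) (S' := regs m (false :: a) b c) ?_
      (by simpa [Tree.code] using h)).mono (by simp only [Tree.code, List.length_singleton]; omega)
    refine Runs.popCase (r := .main) (t := 1) ?_
    simpa [Tree.code] using Runs.push_a false
  | cons x y hx hy =>
    intro m a b c S t h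
    have h₁ : Runs (Γ₀ := Γ₀) _ _ _ _ := hx (y.code ++ m) (true :: a) b (true :: c)
      (hy m (x.code.reverse ++ true :: a) b c (by simpa [Tree.code] using h))
    refine (Runs.loop_step (by simp) (s := 4)
      (S' := regs (x.code ++ (y.code ++ m)) (true :: a) b (true :: true :: c)) ?_ h₁).mono
      (by simp [Tree.code]; omega)
    refine Runs.popCase (r := .main) (t := 3) ?_
    simpa [Tree.code] using
      (Runs.push_a true).seq ((Runs.push_c true).seq (Runs.push_c true))

theorem Runs.moveTo_b_loop (x : Tree) : ∀ (m a b c : List Bool) {S : Reg → List Bool} {t : ℕ},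
    Runs (Γ₀ := Γ₀) (moveLoop .b) (regs m a (x.code.reverse ++ b) c) S t →
    Runs (Γ₀ := Γ₀) (moveLoop .b) (regs (x.code ++ m) a b (true :: c)) S
      (5 * x.code.length + t) := by
  unfold moveLoop
  induction x with
  | nil =>
    intro m a b c S t h
    refine (Runs.loop_step (by simp) (s := 2) (S' := regs m a (false :: b) c) ?_
      (by simpa [Tree.code] using h)).mono (by simp only [Tree.code, List.length_singleton]; omega)
    refine Runs.popCase (r := .main) (t := 1) ?_
    simpa [Tree.code] using Runs.push_b false
  | cons x y hx hy =>
    intro m a b c S t h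
    have h₁ : Runs (Γ₀ := Γ₀) _ _ _ _ := hx (y.code ++ m) a (true :: b) (true :: c)
      (hy m a (x.code.reverse ++ true :: b) c (by simpa [Tree.code] using h))
    refine (Runs.loop_step (by simp) (s := 4)
      (S' := regs (x.code ++ (y.code ++ m)) a (true :: b) (true :: true :: c)) ?_ h₁).mono
      (by simp [Tree.code]; omega)
    refine Runs.popCase (r := .main) (t := 3) ?_
    simpa [Tree.code] using
      (Runs.push_b true).seq ((Runs.push_c true).seq (Runs.push_c true))

theorem Runs.moveTo_a (x : Tree) (m a b : List Bool) :
    Runs (Γ₀ := Γ₀) (StackMachine.moveTo .a) (regs (x.code ++ m) a b [])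
      (regs m (x.code.reverse ++ a) b [])
      (5 * x.code.length + 2) :=
  ((Runs.push_c true).seq (Runs.moveTo_a_loop x m a b []
    (t := 1) (by
      unfold moveLoop
      simpa using Runs.loop_stop (Γ₀ := Γ₀) (r := .c) (S := regs m (x.code.reverse ++ a) b [])
        (by simp)))).mono (by omega)

theorem Runs.moveTo_b (x : Tree) (m a b : List Bool) :
    Runs (Γ₀ := Γ₀) (StackMachine.moveTo .b) (regs (x.code ++ m) a b [])
      (regs m a (x.code.reverse ++ b) [])
      (5 * x.code.length + 2) :=
  ((Runs.push_c true).seq (Runs.moveTo_b_loop x m a b []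
    (t := 1) (by
      unfold moveLoop
      simpa using Runs.loop_stop (Γ₀ := Γ₀) (r := .c) (S := regs m a (x.code.reverse ++ b) [])
        (by simp)))).mono (by omega)

theorem Runs.flush (r : Reg) (l : List Bool) : ∀ S : Reg → List Bool, S r = l →
    Runs (Γ₀ := Γ₀) (StackMachine.flush r) S (update S r []) (2 * l.length + 1) := by
  induction l with
  | nil =>
    intro S h
    have h₁ := Runs.loop_stop (Γ₀ := Γ₀) (r := r) (S := S) (exits := fun o => o.isNone)
      (P := fun _ => Prog.skip) (by simp [h])
    rw [h] at h₁
    exact h₁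
  | cons x l ih =>
    intro S h
    have h₁ := ih (update S r l) (by simp)
    rw [update_idem] at h₁
    have h₂ : Runs (Γ₀ := Γ₀) _ _ _ _ := Runs.loop_step (exits := fun o => o.isNone) (r := r)
      (S := S) (P := fun _ => Prog.skip) (by simp [h]) (by rw [h]; exact Runs.skip) h₁
    exact h₂.mono (by simp; omega)

theorem Runs.pour {r r' : Reg} (hr : r ≠ r') (l : List Bool) :
    ∀ S : Reg → List Bool, S r = l →
    Runs (Γ₀ := Γ₀) (StackMachine.pour r r') S (update (update S r []) r' (l.reverse ++ S r'))
      (2 * l.length + 1) := by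
  induction l with
  | nil =>
    intro S h
    have := Runs.loop_stop (Γ₀ := Γ₀) (r := r) (S := S) (exits := fun o => o.isNone)
      (P := fun o => Prog.push r' (o == some true)) (by simp [h])
    rw [StackMachine.pour]
    convert this using 1
    swap
    · simp
    funext k
    by_cases hk : k = r' <;> by_cases hk' : k = r <;> simp_all [update]
  | cons x l ih =>
    intro S h
    have h₁ := ih (update (update S r l) r' (x :: S r')) (by simp [update, hr])
    have h₂ : Runs (Γ₀ := Γ₀) _ _ _ _ := Runs.loop_step (exits := fun o => o.isNone) (r := r)
      (S := S) (P := fun o => Prog.push r' (o == some true)) (by simp [h]) (s := 1)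
      (S' := update (update S r l) r' (x :: S r'))
      (by
        have := Runs.push (Γ₀ := Γ₀) (S := update S r l) r' x
        rw [update_of_ne hr.symm] at this
        simpa [h] using this) h₁
    rw [StackMachine.pour]
    convert h₂.mono (t := 2 * (x :: l).length + 1) (by simp; omega) using 1
    funext k
    by_cases hk : k = r' <;> by_cases hk' : k = r <;> simp_all [update]

theorem Runs.pour_a_main (m l b c : List Bool) :
    Runs (Γ₀ := Γ₀) (StackMachine.pour .a .main) (regs m l b c) (regs (l.reverse ++ m) [] b c)
      (2 * l.length + 1) := by
  simpa using Runs.pour (Γ₀ := Γ₀) (r := .a) (r' := .main) (by simp) l (regs m l b c) rfl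

theorem Runs.pour_b_main (m a l c : List Bool) :
    Runs (Γ₀ := Γ₀) (StackMachine.pour .b .main) (regs m a l c) (regs (l.reverse ++ m) a [] c)
      (2 * l.length + 1) := by
  simpa using Runs.pour (Γ₀ := Γ₀) (r := .b) (r' := .main) (by simp) l (regs m a l c) rfl

theorem Runs.pour_b_a (m a l c : List Bool) :
    Runs (Γ₀ := Γ₀) (StackMachine.pour .b .a) (regs m a l c) (regs m (l.reverse ++ a) [] c)
      (2 * l.length + 1) := by
  simpa using Runs.pour (Γ₀ := Γ₀) (r := .b) (r' := .a) (by simp) l (regs m a l c) rfl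

/-- Remove a tree from the main stack. -/
def drop : Prog Γ₀ := (moveTo .a).seq (flush .a)

/-- Move everything from the stack `a` to the main stack and to the stack `b`. -/
def copyLoop : Prog Γ₀ :=
  loop .a (fun o => o.isNone) fun o =>
    (push .main (o == some true)).seq (push .b (o == some true))

/-- Duplicate a tree on the main stack. -/
def dup : Prog Γ₀ :=
  (moveTo .a).seq <| copyLoop.seq <|
  (pour .b .a).seq (pour .a .main)

/-- Exchange two trees on the main stack. -/
def swap : Prog Γ₀ :=
  (moveTo .a).seq <| (moveTo .b).seq <| (pour .a .main).seq (pour .b .main)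

theorem Runs.drop (x : Tree) (m : List Bool) :
    Runs (Γ₀ := Γ₀) StackMachine.drop (regs (x.code ++ m) [] [] []) (regs m [] [] [])
      (7 * x.code.length + 3) := by
  refine ((Runs.moveTo_a x m [] []).seq ?_).mono (s := 5 * x.code.length + 2 +
    (2 * x.code.length + 1)) (by omega)
  have h := Runs.flush (Γ₀ := Γ₀) .a x.code.reverse
    (regs m (x.code.reverse ++ []) [] []) (by simp)
  rwa [update_regs_a, List.length_reverse] at h

theorem Runs.copy_loop (l : List Bool) : ∀ m b : List Bool,
    Runs (Γ₀ := Γ₀) copyLoop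
      (regs m l b []) (regs (l.reverse ++ m) [] (l.reverse ++ b) []) (3 * l.length + 1) := by
  unfold copyLoop
  induction l with
  | nil =>
    intro m b
    simpa using Runs.loop_stop (Γ₀ := Γ₀) (r := .a) (S := regs m [] b []) (by simp)
  | cons x l ih =>
    intro m b
    refine (Runs.loop_step (by simp) (s := 2) (S' := regs (x :: m) l (x :: b) []) ?_
      (by simpa using ih (x :: m) (x :: b))).mono (by simp; omega)
    simpa using (Runs.push_main x).seq (Runs.push_b x)

/-- Every transfer between stacks reverses a word. The second copy lies on `b` in its original
direction, so it needs the detour through `a` to reach the main stack unreversed. -/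
theorem Runs.dup (x : Tree) (m : List Bool) :
    Runs (Γ₀ := Γ₀) StackMachine.dup (regs (x.code ++ m) [] [] [])
      (regs (x.code ++ (x.code ++ m)) [] [] []) (12 * x.code.length + 5) := by
  have h₁ : Runs (Γ₀ := Γ₀) _ _ _ _ := Runs.moveTo_a x m [] []
  have h₂ : Runs (Γ₀ := Γ₀) _ _ _ _ := Runs.copy_loop x.code.reverse m []
  have h₃ : Runs (Γ₀ := Γ₀) _ _ _ _ := Runs.pour_b_a (x.code ++ m) [] x.code []
  have h₄ : Runs (Γ₀ := Γ₀) _ _ _ _ := Runs.pour_a_main (x.code ++ m) x.code.reverse [] []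
  simp only [List.append_nil, List.reverse_reverse, List.length_reverse] at h₁ h₂ h₃ h₄
  exact (h₁.seq (h₂.seq (h₃.seq h₄))).mono (by omega)

theorem Runs.swap (x y : Tree) (m : List Bool) :
    Runs (Γ₀ := Γ₀) StackMachine.swap (regs (x.code ++ (y.code ++ m)) [] [] [])
      (regs (y.code ++ (x.code ++ m)) [] [] []) (7 * (x.code.length + y.code.length) + 6) := by
  have h₁ : Runs (Γ₀ := Γ₀) _ _ _ _ := Runs.moveTo_a x (y.code ++ m) [] []
  have h₂ : Runs (Γ₀ := Γ₀) _ _ _ _ := Runs.moveTo_b y m x.code.reverse []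
  have h₃ : Runs (Γ₀ := Γ₀) _ _ _ _ := Runs.pour_a_main m x.code.reverse y.code.reverse []
  have h₄ : Runs (Γ₀ := Γ₀) _ _ _ _ := Runs.pour_b_main (x.code ++ m) [] y.code.reverse []
  simp only [List.append_nil, List.reverse_reverse, List.length_reverse] at h₁ h₂ h₃ h₄
  exact (h₁.seq (h₂.seq (h₃.seq h₄))).mono (by omega)

/-- Push a word on the main stack. -/
def pushWord : List Bool → Prog Γ₀
  | [] => skip
  | x :: l => (pushWord l).seq (push .main x)

theorem Runs.pushWord (l m : List Bool) :
    Runs (Γ₀ := Γ₀) (StackMachine.pushWord l) (regs m [] [] []) (regs (l ++ m) [] [] []) (l.length + 1) := by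
  induction l with
  | nil => exact Runs.skip
  | cons x l ih => exact (ih.seq (Runs.push_main x)).mono (by simp)

/-- Pop a symbol from the main stack and continue accordingly. -/
def caseMain (P Q : Prog Γ₀) : Prog Γ₀ :=
  popCase .main fun o => match o with
    | some true => P
    | _ => Q

theorem Runs.caseMain_true {P Q : Prog Γ₀} {m a b c : List Bool} {S : Reg → List Bool} {t : ℕ}
    (h : Runs P (regs m a b c) S t) :
    Runs (StackMachine.caseMain P Q) (regs (true :: m) a b c) S (1 + t) :=
  Runs.popCase (by simpa using h)

theorem Runs.caseMain_false {P Q : Prog Γ₀} {m a b c : List Bool} {S : Reg → List Bool} {t : ℕ}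
    (h : Runs Q (regs m a b c) S t) :
    Runs (StackMachine.caseMain P Q) (regs (false :: m) a b c) S (1 + t) :=
  Runs.popCase (by simpa using h)

/-- Remove one symbol from the main stack. -/
def popMain : Prog Γ₀ := caseMain skip skip

theorem Runs.popMain {x : Bool} {m a b c : List Bool} :
    Runs (Γ₀ := Γ₀) StackMachine.popMain (regs (x :: m) a b c) (regs m a b c) 2 := by
  cases x
  · exact Runs.caseMain_false Runs.skip
  · exact Runs.caseMain_true Runs.skip

/-- Leave marks on the stack `c` if the stack `a` is not an initial segment of the stack `b`. -/
def compareLoop : Prog Γ₀ :=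
  loop .a (fun o => o.isNone) fun o => popCase .b fun o' =>
    if o = o' then skip else push .c true

/-- Leave marks on the stack `c` if the stack `b` is not empty. -/
def restLoop : Prog Γ₀ := loop .b (fun o => o.isNone) fun _ => push .c true

/-- Compare the stacks `a` and `b`, leaving marks on the stack `c` if they differ. -/
def compare : Prog Γ₀ := compareLoop.seq restLoop

/-- A mismatch leaves a mark on `c`, and surplus symbols stay on `b`. Both stacks are thus empty at
the end exactly if the words agree and no earlier mark was present; the arbitrary initial `c`
carries this through the induction. -/
theorem Runs.compare_loop (l : List Bool) : ∀ m b c : List Bool, ∃ b' c' : List Bool,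
    b'.length ≤ b.length ∧ c'.length ≤ c.length + l.length ∧
    ((b' = [] ∧ c' = []) ↔ (l = b ∧ c = [])) ∧
    Runs (Γ₀ := Γ₀) compareLoop
      (regs m l b c) (regs m [] b' c') (3 * l.length + 1) := by
  unfold compareLoop
  induction l with
  | nil =>
    intro m b c
    refine ⟨b, c, le_rfl, by simp, by simp [eq_comm], ?_⟩
    simpa using Runs.loop_stop (Γ₀ := Γ₀) (r := .a) (S := regs m [] b c) (by simp)
  | cons x l ih =>
    intro m b c
    by_cases hx : some x = b.head?
    · obtain ⟨b', c', hb, hc, he, h⟩ := ih m b.tail c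
      refine ⟨b', c', hb.trans (by simp), by simp; omega, ?_, ?_⟩
      · rw [he]
        cases b <;> simp_all
      · refine (Runs.loop_step (by simp) (s := 2) (S' := regs m l b.tail c) ?_
          h).mono (by simp; omega)
        refine Runs.popCase (r := .b) (t := 1) ?_
        simpa [hx.symm] using Runs.skip
    · obtain ⟨b', c', hb, hc, he, h⟩ := ih m b.tail (true :: c)
      refine ⟨b', c', hb.trans (by simp), by simp at hc ⊢; omega, ?_, ?_⟩
      · rw [he]
        cases b <;> simp_all
      · refine (Runs.loop_step (by simp) (s := 2) (S' := regs m l b.tail (true :: c)) ?_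
          h).mono (by simp; omega)
        refine Runs.popCase (r := .b) (t := 1) ?_
        simpa [hx] using Runs.push_c true

theorem Runs.compare_rest (b : List Bool) : ∀ m c : List Bool, ∃ c' : List Bool,
    c'.length ≤ c.length + b.length ∧ (c' = [] ↔ (b = [] ∧ c = [])) ∧
    Runs (Γ₀ := Γ₀) restLoop
      (regs m [] b c) (regs m [] [] c') (2 * b.length + 1) := by
  unfold restLoop
  induction b with
  | nil =>
    intro m c
    refine ⟨c, by simp, by simp, ?_⟩
    simpa using Runs.loop_stop (Γ₀ := Γ₀) (r := .b) (S := regs m [] [] c) (by simp)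
  | cons x b ih =>
    intro m c
    obtain ⟨c', hc, he, h⟩ := ih m (true :: c)
    refine ⟨c', by simp at hc ⊢; omega, by simp [he], ?_⟩
    refine (Runs.loop_step (by simp) (s := 1) (S' := regs m [] b (true :: c)) ?_
      h).mono (by simp; omega)
    simpa using Runs.push_c true

theorem Runs.compare (m a b : List Bool) : ∃ c : List Bool,
    c.length ≤ a.length + b.length ∧ (c = [] ↔ a = b) ∧
    Runs (Γ₀ := Γ₀) StackMachine.compare (regs m a b []) (regs m [] [] c) (3 * a.length + 2 * b.length + 2) := by
  obtain ⟨b', c', hb, hc, he, h⟩ := Runs.compare_loop (Γ₀ := Γ₀) a m b []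
  obtain ⟨c'', hc', he', h'⟩ := Runs.compare_rest (Γ₀ := Γ₀) b' m c'
  refine ⟨c'', by simp at hc; omega, by rw [he', he]; simp, (h.seq h').mono (by omega)⟩

/-- Replace two trees on the main stack by the answer whether they are equal. -/
def eqTest : Prog Γ₀ :=
  (moveTo .a).seq <| (moveTo .b).seq <| compare.seq <|
  popCase .c fun o => (flush .c).seq <| match o with
    | none => pushWord (Tree.cons .nil .nil).code
    | some _ => pushWord Tree.nil.code

open Classical in
theorem Runs.eqTest (x y : Tree) (m : List Bool) :
    Runs (Γ₀ := Γ₀) StackMachine.eqTest (regs (x.code ++ (y.code ++ m)) [] [] [])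
      (regs ((if x = y then Tree.cons .nil .nil else .nil).code ++ m) [] [] [])
      (10 * (x.code.length + y.code.length) + 12) := by
  have h₁ : Runs (Γ₀ := Γ₀) _ _ _ _ := Runs.moveTo_a x (y.code ++ m) [] []
  have h₂ : Runs (Γ₀ := Γ₀) _ _ _ _ := Runs.moveTo_b y m x.code.reverse []
  obtain ⟨c, hc, he, h₃⟩ := Runs.compare (Γ₀ := Γ₀) m x.code.reverse y.code.reverse
  have he' : c = [] ↔ x = y := by
    rw [he, List.reverse_inj, Tree.code_injective.eq_iff]
  simp only [List.append_nil, List.length_reverse] at h₁ h₂ h₃ hc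
  refine (h₁.seq (h₂.seq (h₃.seq (t := 2 * c.length + 6) ?_))).mono (by omega)
  -- The first mark decides the answer; the others have to be cleared, since programs on the main
  -- stack expect `c` to be empty.
  have h₄ := Runs.flush (Γ₀ := Γ₀) .c c.tail (regs m [] [] c.tail) rfl
  simp only [update_regs_c] at h₄
  refine (Runs.popCase (r := .c) (t := 2 * c.tail.length + 1 + 4) ?_).mono (by simp; omega)
  rw [regs_c, update_regs_c]
  refine h₄.seq ?_
  simp only [← he']
  rcases c with _ | ⟨x, c⟩
  · simpa [Tree.code] using Runs.pushWord (Γ₀ := Γ₀) (Tree.cons .nil .nil).code m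
  · simpa using (Runs.pushWord (Γ₀ := Γ₀) Tree.nil.code m).mono (by simp [Tree.code])

end StackMachine

/-! ### Polynomial time functions -/

namespace StackMachine

open Function

theorem eval_mono (p : Polynomial ℕ) {m n : ℕ} (h : m ≤ n) : p.eval m ≤ p.eval n := by
  induction p using Polynomial.induction_on' with
  | add p q hp hq => simpa using add_le_add hp hq
  | monomial k a => simpa using Nat.mul_le_mul_left a (Nat.pow_le_pow_left h k)

/-! ### Data types represented by trees, and their sizes -/

/-- Types whose elements are represented by binary trees. -/
class TreeCode (α : Type) where
  tree : α → Tree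
  tree_injective : Injective tree

open TreeCode

variable {α β γ δ : Type} [TreeCode α] [TreeCode β] [TreeCode γ] [TreeCode δ]

/-- The word that represents an element. -/
def code (x : α) : List Bool := (tree x).code

/-- The length of the word that represents an element. -/
def size (x : α) : ℕ := (code x).length

theorem one_le_size (x : α) : 1 ≤ size x := Tree.one_le_length_code _

instance : TreeCode Unit := ⟨fun _ => .nil, fun _ _ _ => rfl⟩

instance : TreeCode Bool where
  tree b := cond b (.cons .nil .nil) .nil
  tree_injective := by rintro (_ | _) (_ | _) h <;> simp_all

instance : TreeCode (α × β) where
  tree x := .cons (tree x.1) (tree x.2)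
  tree_injective := by
    rintro ⟨x, y⟩ ⟨x', y'⟩ h
    simp only [Tree.cons.injEq] at h
    rw [tree_injective h.1, tree_injective h.2]

/-- The tree that represents a list. -/
def listTree : List α → Tree
  | [] => .nil
  | x :: l => .cons (tree x) (listTree l)

theorem listTree_injective : Injective (listTree (α := α))
  | [], [], _ => rfl
  | [], _ :: _, h => by simp [listTree] at h
  | _ :: _, [], h => by simp [listTree] at h
  | x :: l, y :: l', h => by
    simp only [listTree, Tree.cons.injEq] at h
    rw [tree_injective h.1, listTree_injective h.2]

instance : TreeCode (List α) := ⟨listTree, listTree_injective⟩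

/-- Natural numbers are represented in unary. -/
instance : TreeCode ℕ where
  tree n := tree (List.replicate n ())
  tree_injective := by
    intro m n h
    simpa using congrArg List.length (tree_injective h)

theorem code_pair (x : α) (y : β) : code (x, y) = true :: (code x ++ code y) := rfl
theorem code_nil : code ([] : List α) = [false] := rfl
theorem code_cons (x : α) (l : List α) : code (x :: l) = true :: (code x ++ code l) := rfl
theorem code_true : code true = [true, false, false] := rfl
theorem code_false : code false = [false] := rfl

@[simp] theorem size_pair (x : α) (y : β) : size (x, y) = size x + size y + 1 := by
  simp [size, code_pair]
@[simp] theorem size_nil : size ([] : List α) = 1 := rfl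
@[simp] theorem size_cons (x : α) (l : List α) : size (x :: l) = size x + size l + 1 := by
  simp [size, code_cons]
theorem size_bool_le (b : Bool) : size b ≤ 3 := by cases b <;> decide
@[simp] theorem size_nat (n : ℕ) : size n = 2 * n + 1 := by
  have h : size n = size (List.replicate n ()) := rfl
  rw [h]
  induction n with
  | zero => rfl
  | succ n ih =>
    rw [List.replicate_succ, size_cons, ih rfl]
    have : size () = 1 := rfl
    omega

theorem length_lt_size (l : List α) : l.length < size l := by
  induction l with
  | nil => simp
  | cons x l ih => simp; omega

theorem size_le_of_mem {x : α} {l : List α} (h : x ∈ l) : size x ≤ size l := by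
  induction l with
  | nil => simp at h
  | cons y l ih =>
    rcases List.mem_cons.1 h with rfl | h
    · simp; omega
    · have := ih h; simp; omega

/-- The end mark of the first list disappears. -/
theorem size_append (l l' : List α) : size (l ++ l') + 1 = size l + size l' := by
  induction l with
  | nil => simp; omega
  | cons x l ih => simp; omega

theorem size_le_of_suffix {l l' : List α} (h : l <:+ l') : size l ≤ size l' := by
  obtain ⟨k, rfl⟩ := h
  have := size_append k l
  have := one_le_size k
  omega

theorem size_le_of_sublist {l l' : List α} (h : l.Sublist l') : size l ≤ size l' := by
  induction h with
  | slnil => rfl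
  | cons x _ ih => simp; omega
  | cons_cons x _ ih => simp; omega

/-! ### Closure properties of polynomial time functions -/

/-- Functions that are computed in polynomial time on the main stack. -/
def PolyTime (f : α → β) : Prop :=
  ∃ (P : ∀ Γ₀, Prog Γ₀) (p : Polynomial ℕ), ∀ x, size (f x) ≤ p.eval (size x) ∧
    ∀ Γ₀ m, Runs (P Γ₀) (regs (code x ++ m) [] [] []) (regs (code (f x) ++ m) [] [] [])
      (p.eval (size x))

namespace PolyTime

theorem mk {f : α → β} (P : ∀ Γ₀, Prog Γ₀) (p q : Polynomial ℕ)
    (hp : ∀ x, size (f x) ≤ p.eval (size x))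
    (hq : ∀ x Γ₀ m, Runs (P Γ₀) (regs (code x ++ m) [] [] []) (regs (code (f x) ++ m) [] [] [])
      (q.eval (size x))) : PolyTime f :=
  ⟨P, p + q, fun x => ⟨(hp x).trans (by simp), fun Γ₀ m => (hq x Γ₀ m).mono (by simp)⟩⟩

theorem size_le {f : α → β} (hf : PolyTime f) :
    ∃ p : Polynomial ℕ, ∀ x, size (f x) ≤ p.eval (size x) :=
  let ⟨_, p, h⟩ := hf
  ⟨p, fun x => (h x).1⟩

/-- Changing the type without changing the tree costs nothing; for instance, a pair of a head and a
tail already is the code of a list. -/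
theorem of_tree_eq {f : α → β} (h : ∀ x, tree (f x) = tree x) : PolyTime f := by
  have h' : ∀ x, code (f x) = code x := fun x => by rw [code, h, code]
  refine mk (fun _ => .skip) .X 1 (fun x => by simp [size, h']) fun x Γ₀ m => ?_
  rw [h']
  simpa using Runs.skip

theorem id : PolyTime (fun x : α => x) := of_tree_eq fun _ => rfl

/-- The second program runs on an input of size at most `p.eval (size x)`. This is why `PolyTime`
bounds the size of values together with the time. -/
theorem comp {g : β → γ} {f : α → β} (hg : PolyTime g) (hf : PolyTime f) :
    PolyTime (fun x => g (f x)) := by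
  obtain ⟨Q, q, hQ⟩ := hg
  obtain ⟨P, p, hP⟩ := hf
  refine mk (fun Γ₀ => (P Γ₀).seq (Q Γ₀)) (q.comp p) (p + q.comp p) (fun x => ?_) fun x Γ₀ m => ?_
  · rw [Polynomial.eval_comp]
    exact (hQ (f x)).1.trans (eval_mono q (hP x).1)
  · refine (((hP x).2 Γ₀ m).seq ((hQ (f x)).2 Γ₀ m)).mono ?_
    rw [Polynomial.eval_add, Polynomial.eval_comp]
    exact Nat.add_le_add_left (eval_mono q (hP x).1) _

theorem const (c : β) : PolyTime (fun _ : α => c) := by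
  refine mk (fun Γ₀ => drop.seq (pushWord (code c))) (.C (size c)) (.C 7 * .X + 3 + .C (size c + 1))
    (fun x => by simp) fun x Γ₀ m => ?_
  refine ((Runs.drop (tree x) m).seq (Runs.pushWord (code c) m)).mono ?_
  simp only [Polynomial.eval_add, Polynomial.eval_mul, Polynomial.eval_C, Polynomial.eval_X,
    Polynomial.eval_ofNat]
  exact le_rfl

theorem fst : PolyTime (fun x : α × β => x.1) := by
  refine mk (fun Γ₀ => popMain.seq (swap.seq drop)) .X (.C 14 * .X + 20)
    (fun x => by rcases x with ⟨x, y⟩; simp; omega) fun ⟨x, y⟩ Γ₀ m => ?_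
  have h₁ := Runs.swap (Γ₀ := Γ₀) (tree x) (tree y) m
  have h₂ := Runs.drop (Γ₀ := Γ₀) (tree y) ((tree x).code ++ m)
  rw [code_pair, List.cons_append, List.append_assoc]
  refine (Runs.popMain.seq (h₁.seq h₂)).mono ?_
  simp only [Polynomial.eval_add, Polynomial.eval_mul, Polynomial.eval_C, Polynomial.eval_X,
    Polynomial.eval_ofNat, size_pair]
  simp only [size, code]
  omega

theorem snd : PolyTime (fun x : α × β => x.2) := by
  refine mk (fun Γ₀ => popMain.seq drop) .X (.C 7 * .X + 20)
    (fun x => by rcases x with ⟨x, y⟩; simp; omega) fun ⟨x, y⟩ Γ₀ m => ?_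
  have h₂ := Runs.drop (Γ₀ := Γ₀) (tree x) ((tree y).code ++ m)
  rw [code_pair, List.cons_append, List.append_assoc]
  refine (Runs.popMain.seq h₂).mono ?_
  simp only [Polynomial.eval_add, Polynomial.eval_mul, Polynomial.eval_C, Polynomial.eval_X,
    Polynomial.eval_ofNat, size_pair]
  simp only [size, code]
  omega

/-- The argument is duplicated, one copy is consumed, and the swap brings the other copy above the
finished value. The final push is the root mark of the pair. -/
theorem pair {f : α → β} {g : α → γ} (hf : PolyTime f) (hg : PolyTime g) :
    PolyTime (fun x => (f x, g x)) := by
  obtain ⟨Q, q, hQ⟩ := hg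
  obtain ⟨P, p, hP⟩ := hf
  refine mk (fun Γ₀ => dup.seq ((Q Γ₀).seq (swap.seq ((P Γ₀).seq (.push .main true)))))
    (p + q + 1) (.C 30 * (.X + p + q + 1)) (fun x => ?_) fun x Γ₀ m => ?_
  · have := (hP x).1
    have := (hQ x).1
    simp; omega
  · have h₁ := Runs.dup (Γ₀ := Γ₀) (tree x) m
    have h₂ := (hQ x).2 Γ₀ (code x ++ m)
    have h₃ := Runs.swap (Γ₀ := Γ₀) (tree (g x)) (tree x) m
    have h₄ := (hP x).2 Γ₀ (code (g x) ++ m)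
    have h₅ := Runs.push_main (Γ₀ := Γ₀) (m := code (f x) ++ (code (g x) ++ m)) (a := [])
      (b := []) (c := []) true
    have := (hP x).1
    have := (hQ x).1
    rw [code_pair, List.cons_append, List.append_assoc]
    refine (h₁.seq (h₂.seq (h₃.seq (h₄.seq h₅)))).mono ?_
    simp [size, code] at *
    omega

theorem cons {f : α → β} {g : α → List β} (hf : PolyTime f) (hg : PolyTime g) :
    PolyTime (fun x => f x :: g x) :=
  (of_tree_eq (f := fun y : β × List β => y.1 :: y.2) fun _ => rfl).comp (hf.pair hg)

theorem cond {b : α → Bool} {f g : α → β} (hb : PolyTime b) (hf : PolyTime f) (hg : PolyTime g) :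
    PolyTime (fun x => cond (b x) (f x) (g x)) := by
  obtain ⟨R, r, hR⟩ := hb
  obtain ⟨Q, q, hQ⟩ := hg
  obtain ⟨P, p, hP⟩ := hf
  refine mk (fun Γ₀ => dup.seq ((R Γ₀).seq (caseMain (popMain.seq (popMain.seq (P Γ₀))) (Q Γ₀))))
    (p + q) (.C 30 * (.X + p + q + r + 1)) (fun x => ?_) fun x Γ₀ m => ?_
  · have := (hP x).1
    have := (hQ x).1
    cases b x <;> simp <;> omega
  · have h₁ := Runs.dup (Γ₀ := Γ₀) (tree x) m
    have h₂ := (hR x).2 Γ₀ (code x ++ m)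
    cases hb : b x
    · rw [hb] at h₂
      refine (h₁.seq (h₂.seq (Runs.caseMain_false ((hQ x).2 Γ₀ m)))).mono ?_
      simp [size, code] at *
      omega
    · rw [hb] at h₂
      -- The code of `true` has three symbols, so two of them remain after the case distinction.
      refine (h₁.seq (h₂.seq (Runs.caseMain_true (Runs.popMain.seq (Runs.popMain.seq
        ((hP x).2 Γ₀ m)))))).mono ?_
      simp [size, code] at *
      omega

theorem eq [DecidableEq β] {f g : α → β} (hf : PolyTime f) (hg : PolyTime g) :
    PolyTime (fun x => decide (f x = g x)) := by
  refine comp (f := fun x => (f x, g x)) (g := fun y => decide (y.1 = y.2)) ?_ (hf.pair hg)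
  refine mk (fun Γ₀ => popMain.seq eqTest) (.C 3) (.C 10 * .X + 20) (fun x => ?_)
    fun ⟨x, y⟩ Γ₀ m => ?_
  · simpa using size_bool_le _
  · have h := Runs.eqTest (Γ₀ := Γ₀) (tree x) (tree y) m
    have e : code (decide (x = y)) =
        (open Classical in if tree x = tree y then Tree.cons .nil .nil else .nil : Tree).code := by
      by_cases hxy : x = y
      · simp [hxy, code, tree]
      · simp [hxy, tree_injective.eq_iff, code, tree]
    rw [code_pair, List.cons_append, List.append_assoc, e]
    refine (Runs.popMain.seq h).mono ?_
    simp only [Polynomial.eval_add, Polynomial.eval_mul, Polynomial.eval_C, Polynomial.eval_X,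
      Polynomial.eval_ofNat, size_pair]
    simp only [size, code]
    omega

/-- Once the root mark of the list is popped, two pushed marks turn the stack into the code of `((a,
l₂), (env, z))`, without moving any data. Removing the root mark of the result uncovers the
remaining list, ready for the next round. -/
theorem foldl_loop {g : β → α → β} {Q : ∀ Γ₀, Prog Γ₀} {T : ℕ} {Γ₀ : Type} {m : List Bool}
    {env : δ} (l : List α) :
    ∀ z : β, (∀ l₁ a l₂, l = l₁ ++ a :: l₂ →
      Runs (Q Γ₀) (regs (code ((a, l₂), (env, l₁.foldl g z)) ++ m) [] [] [])
        (regs (code (l₂, (env, (l₁ ++ [a]).foldl g z)) ++ m) [] [] []) T) →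
    Runs (.loop .main (fun o => o != some true) fun _ =>
      (Prog.push .main true).seq ((Prog.push .main true).seq ((Q Γ₀).seq popMain)))
      (regs (code l ++ (code (env, z) ++ m)) [] [] [])
      (regs (code (env, l.foldl g z) ++ m) [] [] []) (l.length * (T + 5) + 1) := by
  induction l with
  | nil =>
    intro z _
    rw [code_nil]
    simpa using Runs.loop_stop (Γ₀ := Γ₀) (r := .main)
      (S := regs ([false] ++ (code (env, z) ++ m)) [] [] []) (exits := fun o => o != some true)
      (by simp)
  | cons a l ih =>
    intro z h
    have h₁ := ih (g z a) fun l₁ b l₂ hl => by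
      simpa using h (a :: l₁) b l₂ (by simp [hl])
    have h₂ := h [] a l rfl
    refine (Runs.loop_step (by simp [code_cons]) (s := T + 4) ?_ h₁).mono
      (by simp only [List.length_cons]; ring_nf; omega)
    have h₃ := Runs.popMain (Γ₀ := Γ₀) (x := true) (m := code l ++ (code (env, g z a) ++ m))
      (a := []) (b := []) (c := [])
    simp only [code_pair (a, l), code_pair l, code_pair a l, List.cons_append, List.append_assoc,
      List.nil_append, List.foldl_cons, List.foldl_nil] at h₂
    simp only [regs_main, code_cons, update_regs_main, List.cons_append, List.append_assoc,
      List.tail_cons]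
    exact ((Runs.push_main true).seq ((Runs.push_main true).seq (h₂.seq h₃))).mono (by omega)

/-- Iterating a function of polynomial growth may produce exponential size. The bound `hq` on the
accumulator after every prefix excludes this, so that all rounds share one time bound. -/
theorem foldl {f : δ → List α} {z : δ → β} {g : δ × β × α → β} (hf : PolyTime f)
    (hz : PolyTime z) (hg : PolyTime g) (q : Polynomial ℕ)
    (hq : ∀ x l, l <+: f x → size (l.foldl (fun b a => g (x, b, a)) (z x)) ≤ q.eval (size x)) :
    PolyTime (fun x => (f x).foldl (fun b a => g (x, b, a)) (z x)) := by
  refine comp (f := fun x => (x, (f x).foldl (fun b a => g (x, b, a)) (z x)))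
    (g := fun y => y.2) snd ?_
  obtain ⟨P, p, hP⟩ := hf.pair (id.pair hz)
  -- The body of the loop also carries the unread list and the parameter `x` along.
  have hbody : PolyTime (fun y : (α × List α) × (δ × β) =>
      (y.1.2, (y.2.1, g (y.2.1, y.2.2, y.1.1)))) :=
    (snd.comp fst).pair ((fst.comp snd).pair
      (hg.comp ((fst.comp snd).pair ((snd.comp snd).pair (fst.comp fst)))))
  obtain ⟨Q, r, hQ⟩ := hbody
  refine mk (fun Γ₀ => (P Γ₀).seq (popMain.seq (.loop .main (fun o => o != some true) fun _ =>
      (Prog.push .main true).seq ((Prog.push .main true).seq ((Q Γ₀).seq popMain)))))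
    (.X + q + 1) (p + 3 + p * (r.comp (p + .X + q + 2) + 5)) (fun x => ?_) fun x Γ₀ m => ?_
  · have := hq x _ List.prefix_rfl
    simp
    omega
  · have hp := (hP x).1
    simp only [size_pair] at hp
    have h₁ := (hP x).2 Γ₀ m
    have h₂ := foldl_loop (Γ₀ := Γ₀) (m := m) (Q := Q) (env := x)
      (T := r.eval (p.eval (size x) + size x + q.eval (size x) + 2))
      (g := fun b a => g (x, b, a)) (f x) (z x) fun l₁ a l₂ hl => by
        have h := (hQ ((a, l₂), (x, l₁.foldl (fun b a => g (x, b, a)) (z x)))).2 Γ₀ m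
        rw [List.foldl_append]
        refine h.mono (eval_mono r ?_)
        have h₃ := hq x l₁ ⟨a :: l₂, hl.symm⟩
        have h₄ : size (a :: l₂) ≤ size (f x) := size_le_of_suffix ⟨l₁, hl.symm⟩
        simp only [size_pair, size_cons] at h₄ ⊢
        omega
    rw [code_pair, List.cons_append, List.append_assoc] at h₁
    refine (h₁.seq (Runs.popMain.seq h₂)).mono ?_
    have h₅ : (f x).length ≤ p.eval (size x) := by
      have := length_lt_size (f x)
      omega
    have h₆ := Nat.mul_le_mul_right
      (r.eval (p.eval (size x) + size x + q.eval (size x) + 2) + 5) h₅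
    simp only [Polynomial.eval_add, Polynomial.eval_mul, Polynomial.eval_comp, Polynomial.eval_X,
      Polynomial.eval_ofNat]
    omega

/-- Folds in which every step increases the size by a bounded amount. -/
theorem foldl_of_le {f : δ → List α} {z : δ → β} {g : δ × β × α → β} (hf : PolyTime f)
    (hz : PolyTime z) (hg : PolyTime g) (q : Polynomial ℕ)
    (hq : ∀ x b, ∀ a ∈ f x, size (g (x, b, a)) ≤ size b + q.eval (size x + size a)) :
    PolyTime (fun x => (f x).foldl (fun b a => g (x, b, a)) (z x)) := by
  obtain ⟨p, hp⟩ := hf.size_le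
  obtain ⟨r, hr⟩ := hz.size_le
  refine foldl hf hz hg (r + p * q.comp (.X + p)) fun x l hl => ?_
  have key : ∀ l : List α, l ⊆ f x → ∀ b, size (l.foldl (fun b a => g (x, b, a)) b) ≤
      size b + l.length * q.eval (size x + p.eval (size x)) := by
    intro l
    induction l with
    | nil => simp
    | cons a l ih =>
      intro hl b
      have h₁ := ih (fun c hc => hl (by simp [hc])) (g (x, b, a))
      have h₂ := hq x b a (hl (by simp))
      have h₃ := eval_mono q (Nat.add_le_add_left
        ((size_le_of_mem (hl (List.mem_cons_self (a := a) (l := l)))).trans (hp x)) (size x))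
      simp only [List.foldl_cons, List.length_cons, Nat.succ_mul]
      omega
  refine (key l hl.subset (z x)).trans ?_
  simp only [Polynomial.eval_add, Polynomial.eval_mul, Polynomial.eval_comp, Polynomial.eval_X]
  refine add_le_add (hr x) (Nat.mul_le_mul_right _ ?_)
  exact hl.length_le.trans ((length_lt_size _).le.trans (hp x))

end PolyTime

end StackMachine

/-! ### From functions on trees to Turing machines -/

namespace StackMachine

open Turing Function TreeCode

/-- Push a word on the main stack, in a single step. -/
def pushStmt {Γ₀ Λ : Type} : List Bool → TM2.Stmt (Sym Γ₀) Λ (Mem Γ₀) →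
    TM2.Stmt (Sym Γ₀) Λ (Mem Γ₀)
  | [], q => q
  | x :: l, q => pushStmt l (.push (some .main) (fun _ => x) q)

theorem stepAux_pushStmt {Γ₀ Λ : Type} (l : List Bool) :
    ∀ (q : TM2.Stmt (Sym Γ₀) Λ (Mem Γ₀)) (v : Mem Γ₀) (i : List Γ₀) (m a b c : List Bool),
    TM2.stepAux (pushStmt l q) v (contents i (regs m a b c)) =
      TM2.stepAux q v (contents i (regs (l ++ m) a b c)) := by
  induction l with
  | nil => intros; rfl
  | cons x l ih => intros; simp [pushStmt, ih, update_contents_some]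

/-- The labels of the machine that computes a function with values in `Bool`. -/
abbrev MachineLabel (Γ₀ : Type) (P : Prog Γ₀) : Type := (Fin 3 ⊕ Γ₀) ⊕ P.Label

/-- The program of the machine that reads its input onto the main stack, where it becomes a reversed
list, then runs `P`, and returns the resulting truth value. -/
def machineStmt {Γ₀ : Type} [TreeCode Γ₀] (P : Prog Γ₀) :
    MachineLabel Γ₀ P → TM2.Stmt (Sym Γ₀) (MachineLabel Γ₀ P) (Mem Γ₀)
  | .inl (.inl 0) => .push (some .main) (fun _ => false) (.goto fun _ => .inl (.inl 1))
  | .inl (.inl 1) => .pop none (fun v o => (v.1, o)) (.goto fun v =>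
      match v.2 with
      | none => .inr P.entry
      | some x => .inl (.inr x))
  | .inl (.inr x) => pushStmt (true :: code x) (.goto fun _ => .inl (.inl 1))
  | .inr l => P.code .inr (.inl (.inl 2)) l
  | .inl (.inl 2) => .pop (some .main) (fun _ o => (o, none)) <|
      .push (some .a) (fun v => v.1 == some true) <|
      .branch (fun v => v.1 == some true)
        (.pop (some .main) (fun v _ => v) <| .pop (some .main) (fun v _ => v) <|
          .load (fun _ => (none, none)) .halt)
        (.load (fun _ => (none, none)) .halt)

/-- The machine that computes a function with values in `Bool`. -/
def machine {Γ₀ : Type} [Fintype Γ₀] [TreeCode Γ₀] (P : Prog Γ₀) : FinTM2 :=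
  haveI := P.fintypeLabel
  { K := Option Reg
    k₀ := none
    k₁ := some .a
    Γ := Sym Γ₀
    Λ := MachineLabel Γ₀ P
    main := .inl (.inl 0)
    σ := Mem Γ₀
    initialState := (none, none)
    Γk₀Fin := (inferInstance : Fintype Γ₀)
    m := machineStmt P }

theorem initList_machine {Γ₀ : Type} [Fintype Γ₀] [TreeCode Γ₀] (P : Prog Γ₀) (w : List Γ₀) :
    initList (machine P) w =
      ⟨some (.inl (.inl 0)), (none, none), contents w (regs [] [] [] [])⟩ := by
  refine TM2.Cfg.mk.injEq .. |>.mpr ⟨rfl, rfl, ?_⟩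
  funext k
  rcases k with _ | _ | _ | _ | _ <;> rfl

theorem haltList_machine {Γ₀ : Type} [Fintype Γ₀] [TreeCode Γ₀] (P : Prog Γ₀) (w : List Bool) :
    haltList (machine P) w = ⟨none, (none, none), contents [] (regs [] w [] [])⟩ := by
  refine TM2.Cfg.mk.injEq .. |>.mpr ⟨rfl, rfl, ?_⟩
  funext k
  rcases k with _ | _ | _ | _ | _ <;> rfl

/-- With the code of a list on the stack, pushing `true :: code x` prepends `x` to it. Reading
therefore reverses the input, at two steps per symbol. -/
theorem reachesIn_read {Γ₀ : Type} [TreeCode Γ₀] (P : Prog Γ₀) (w : List Γ₀) :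
    ∀ (l : List Γ₀) (v : Mem Γ₀), ∃ v', ReachesIn (machineStmt P)
      ⟨some (.inl (.inl 1)), v, contents w (regs (code l) [] [] [])⟩
      ⟨some (.inr P.entry), v', contents [] (regs (code (w.reverse ++ l)) [] [] [])⟩
      (2 * w.length + 1) := by
  induction w with
  | nil =>
    intro l v
    exact ⟨(v.1, none), .single (by simp [machineStmt, update_contents_none])⟩
  | cons x w ih =>
    intro l v
    obtain ⟨v', h⟩ := ih (x :: l) (v.1, some x)
    have h₁ : ReachesIn (machineStmt P)
        ⟨some (.inl (.inl 1)), v, contents (x :: w) (regs (code l) [] [] [])⟩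
        ⟨some (.inl (.inr x)), (v.1, some x), contents w (regs (code l) [] [] [])⟩ 1 :=
      .single (by simp [machineStmt, update_contents_none])
    have h₂ : ReachesIn (machineStmt P)
        ⟨some (.inl (.inr x)), (v.1, some x), contents w (regs (code l) [] [] [])⟩
        ⟨some (.inl (.inl 1)), (v.1, some x), contents w (regs (code (x :: l)) [] [] [])⟩ 1 :=
      .single (by rw [machineStmt, stepAux_pushStmt]; simp [code_cons])
    refine ⟨v', ((h₁.trans h₂).trans (by simpa using h)).mono (by simp; omega)⟩

/-- A halting configuration must have every stack except the output stack empty, so the two further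
symbols in the code of `true` are popped as well. -/
theorem reachesIn_finish {Γ₀ : Type} [TreeCode Γ₀] (P : Prog Γ₀) (b : Bool) (v : Mem Γ₀) :
    ReachesIn (machineStmt P)
      ⟨some (.inl (.inl 2)), v, contents [] (regs (code b) [] [] [])⟩
      ⟨none, (none, none), contents [] (regs [] [b] [] [])⟩ 1 := by
  refine .single ?_
  cases b <;>
    simp [machineStmt, code_true, code_false, update_contents_some]

/-- Over a finite alphabet the symbols have bounded size, so polynomial in the size means polynomial
in the length of the input word. -/
theorem size_list_le {Γ₀ : Type} [Fintype Γ₀] [TreeCode Γ₀] (l : List Γ₀) :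
    size l ≤ ((∑ x : Γ₀, size x) + 1) * l.length + 1 := by
  induction l with
  | nil => simp
  | cons x l ih =>
    have h : size x ≤ ∑ x : Γ₀, size x :=
      Finset.single_le_sum (f := fun x : Γ₀ => size x) (fun _ _ => Nat.zero_le _)
        (Finset.mem_univ x)
    rw [size_cons, List.length_cons, Nat.mul_succ]
    omega

/-- A problem is in polynomial time if it is solved by a polynomial time function on trees. -/
theorem PolyTime.decidableInPolyTime {Γ₀ : Type} [Fintype Γ₀] [TreeCode Γ₀] {f : List Γ₀ → Bool}
    (hf : PolyTime f) {α : Type} {enc : α → List Γ₀} {p : α → Prop}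
    (h : ∀ x, f (enc x).reverse = true ↔ p x) : DecidableInPolyTime enc p := by
  classical
  obtain ⟨P, q, hP⟩ := hf
  have key : ∀ x : α, ReachesIn (machineStmt (P Γ₀))
      ⟨some (.inl (.inl 0)), (none, none), contents (enc x) (regs [] [] [] [])⟩
      ⟨none, (none, none), contents [] (regs [] [decide (p x)] [] [])⟩
      ((2 * .X + 3 + q.comp (.C ((∑ x : Γ₀, size x) + 1) * .X + 1) : Polynomial ℕ).eval
        (enc x).length) := by
    intro x
    have h₁ : ReachesIn (machineStmt (P Γ₀))
        ⟨some (.inl (.inl 0)), (none, none), contents (enc x) (regs [] [] [] [])⟩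
        ⟨some (.inl (.inl 1)), (none, none), contents (enc x) (regs (code ([] : List Γ₀)) [] [] [])⟩
        1 := .single (by simp [machineStmt, update_contents_some, code_nil])
    obtain ⟨v₂, h₂⟩ := reachesIn_read (P Γ₀) (enc x) [] (none, none)
    obtain ⟨v₃, h₃⟩ := (hP (enc x).reverse).2 Γ₀ [] _ (machineStmt (P Γ₀)) .inr (.inl (.inl 2))
      (fun _ => rfl) [] v₂
    have h₄ := reachesIn_finish (P Γ₀) (f (enc x).reverse) v₃
    simp only [List.append_nil] at h₂ h₃
    have e : f (enc x).reverse = decide (p x) := by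
      rw [Bool.eq_iff_iff, h x, decide_eq_true_iff]
    rw [e] at h₃ h₄
    refine (h₁.trans (h₂.trans (h₃.trans h₄))).mono ?_
    have := eval_mono q (size_list_le (enc x).reverse)
    simp only [List.length_reverse] at this
    simp only [Polynomial.eval_add, Polynomial.eval_mul, Polynomial.eval_comp, Polynomial.eval_X,
      Polynomial.eval_C, Polynomial.eval_one, Polynomial.eval_ofNat]
    omega
  refine ⟨⟨⟨machine (P Γ₀), Equiv.refl _, Equiv.refl _⟩,
    2 * .X + 3 + q.comp (.C ((∑ x : Γ₀, size x) + 1) * .X + 1), fun x => ?_⟩⟩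
  refine ⟨⟨(key x).choose, ?_⟩, (key x).choose_spec.1⟩
  have e₁ : initList (machine (P Γ₀)) (List.map (Equiv.refl Γ₀).invFun (enc x)) =
      ⟨some (.inl (.inl 0)), (none, none), contents (enc x) (regs [] [] [] [])⟩ :=
    (congrArg (initList (machine (P Γ₀))) (List.map_id _)).trans (initList_machine _ _)
  have e₂ := haltList_machine (P Γ₀) [decide (p x)]
  refine (congrArg (fun c => (flip bind (TM2.step (machineStmt (P Γ₀))))^[(key x).choose]
    (some c)) e₁).trans ((key x).choose_spec.2.trans ?_)
  refine (congrArg some e₂.symm).trans ?_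
  have e₃ : List.map (Equiv.refl Bool).invFun (Computability.encodeBool (decide (p x))) =
      [decide (p x)] := List.map_id _
  refine congrArg (fun w => some (haltList (machine (P Γ₀)) w)) (e₃.symm.trans ?_)
  congr

end StackMachine

/-! ### Small zero-sum subfamilies -/

namespace ZeroSum

open Finset

universe u

variable {ι : Type u} [DecidableEq ι]

/-- The terms outside `t` sum to minus the partial sum, so one of them is zero or has sign opposite
to it. Adding that term cannot push the sum out of the interval. -/
theorem exists_insert {g : ι → ℤ} {Δ : ℕ} {s t : Finset ι} (hg : ∀ i ∈ s, |g i| ≤ Δ)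
    (hs : ∑ i ∈ s, g i = 0) (hts : t ⊂ s) (ht : |∑ i ∈ t, g i| ≤ Δ) :
    ∃ a ∈ s, a ∉ t ∧ |∑ i ∈ insert a t, g i| ≤ Δ := by
  have hne : (s \ t).Nonempty := sdiff_nonempty.2 hts.2
  have hsum : ∑ i ∈ s \ t, g i + ∑ i ∈ t, g i = 0 := by rw [sum_sdiff hts.1, hs]
  rcases le_or_gt (∑ i ∈ t, g i) 0 with h | h
  · obtain ⟨a, ha, hga⟩ := exists_le_of_sum_le (f := fun _ => (0 : ℤ)) (g := g) hne
      (by simp only [sum_const_zero]; omega)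
    rw [mem_sdiff] at ha
    refine ⟨a, ha.1, ha.2, ?_⟩
    have := hg a ha.1
    rw [sum_insert ha.2]
    rw [abs_le] at *
    omega
  · obtain ⟨a, ha, hga⟩ := exists_le_of_sum_le (f := g) (g := fun _ => (0 : ℤ)) hne
      (by simp only [sum_const_zero]; omega)
    rw [mem_sdiff] at ha
    refine ⟨a, ha.1, ha.2, ?_⟩
    have := hg a ha.1
    rw [sum_insert ha.2]
    rw [abs_le] at *
    omega

/-- The family is ordered greedily, which keeps all partial sums small. -/
theorem exists_chain {g : ι → ℤ} {Δ : ℕ} {s : Finset ι} (hg : ∀ i ∈ s, |g i| ≤ Δ)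
    (hs : ∑ i ∈ s, g i = 0) : ∃ t : ℕ → Finset ι, Monotone t ∧
      ∀ k ≤ #s, t k ⊆ s ∧ #(t k) = k ∧ |∑ i ∈ t k, g i| ≤ Δ := by
  have step : ∀ t : Finset ι, ∃ t', t ⊆ t' ∧ (t ⊂ s → |∑ i ∈ t, g i| ≤ Δ →
      t' ⊆ s ∧ #t' = #t + 1 ∧ |∑ i ∈ t', g i| ≤ Δ) := by
    intro t
    by_cases h : t ⊂ s ∧ |∑ i ∈ t, g i| ≤ Δ
    · obtain ⟨a, ha, hat, h'⟩ := exists_insert hg hs h.1 h.2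
      exact ⟨insert a t, subset_insert a t, fun _ _ =>
        ⟨insert_subset ha h.1.1, card_insert_of_notMem hat, h'⟩⟩
    -- Where nothing is required the chain stays constant, which keeps it monotone.
    · exact ⟨t, Subset.rfl, fun h₁ h₂ => (h ⟨h₁, h₂⟩).elim⟩
  choose next hsub hnext using step
  refine ⟨fun k => next^[k] ∅, monotone_nat_of_le_succ fun k => ?_, fun k => ?_⟩
  · rw [Function.iterate_succ_apply']
    exact hsub _
  · induction k with
    | zero => simp
    | succ k ih =>
      intro hk
      obtain ⟨h₁, h₂, h₃⟩ := ih (by omega)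
      dsimp only at h₁ h₂ h₃
      have hne : next^[k] ∅ ⊂ s := by
        refine Finset.ssubset_iff_subset_ne.2 ⟨h₁, fun h => ?_⟩
        have := congrArg card h
        omega
      obtain ⟨h₄, h₅, h₆⟩ := hnext _ hne h₃
      simp only [Function.iterate_succ_apply']
      exact ⟨h₄, by omega, h₆⟩

/-- The first 2Δ + 2 partial sums of the chain take at most 2Δ + 1 values. Two of them agree, and
the terms between these two sum to zero. -/
theorem exists_subset_of_dim_one {g : ι → ℤ} {Δ : ℕ} {s : Finset ι} (hg : ∀ i ∈ s, |g i| ≤ Δ)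
    (hs : ∑ i ∈ s, g i = 0) (hne : s.Nonempty) :
    ∃ t ⊆ s, t.Nonempty ∧ ∑ i ∈ t, g i = 0 ∧ #t ≤ 2 * Δ + 1 := by
  rcases le_or_gt (#s) (2 * Δ + 1) with hc | hc
  · exact ⟨s, Subset.rfl, hne, hs, hc⟩
  obtain ⟨t, hmono, ht⟩ := exists_chain hg hs
  have hmaps : ∀ k ∈ range (2 * Δ + 2), ∑ i ∈ t k, g i ∈ Icc (-(Δ : ℤ)) Δ := by
    intro k hk
    rw [mem_range] at hk
    rw [mem_Icc, ← abs_le]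
    exact (ht k (by omega)).2.2
  obtain ⟨j, hj, k, hk, hjk, he⟩ := exists_ne_map_eq_of_card_lt_of_maps_to
    (by rw [card_range, Int.card_Icc]; omega) hmaps
  rw [mem_range] at hj hk
  wlog hlt : j < k generalizing j k
  · exact this k hk j hj hjk.symm he.symm (by omega)
  have hsub := hmono hlt.le
  have hcard := card_sdiff_add_card_eq_card hsub
  obtain ⟨hk₁, hk₂, -⟩ := ht k (by omega)
  obtain ⟨-, hj₂, -⟩ := ht j (by omega)
  refine ⟨t k \ t j, sdiff_subset.trans hk₁, ?_, ?_, by omega⟩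
  · rw [← card_pos]
    omega
  · have := sum_sdiff (f := g) hsub
    omega

/-- Short zero-sum blocks are split off one after the other; what remains still has sum zero. -/
theorem exists_partition {g : ι → ℤ} {Δ : ℕ} (s : Finset ι) (hg : ∀ i ∈ s, |g i| ≤ Δ)
    (hs : ∑ i ∈ s, g i = 0) : ∃ P : Finset (Finset ι), (P : Set (Finset ι)).PairwiseDisjoint id ∧
      P.biUnion id = s ∧ ∀ b ∈ P, ∑ i ∈ b, g i = 0 ∧ #b ≤ 2 * Δ + 1 := by
  induction s using Finset.strongInduction with
  | H s ih =>
    rcases s.eq_empty_or_nonempty with rfl | hne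
    · exact ⟨∅, by simp⟩
    obtain ⟨t, hts, htne, ht, htc⟩ := exists_subset_of_dim_one hg hs hne
    obtain ⟨P, hP₁, hP₂, hP₃⟩ := ih (s \ t) (sdiff_ssubset hts htne)
      (fun i hi => hg i (mem_sdiff.1 hi).1) (by have := sum_sdiff (f := g) hts; omega)
    refine ⟨insert t P, ?_, ?_, ?_⟩
    · rw [coe_insert]
      refine hP₁.insert fun b hb _ => ?_
      have : b ⊆ s \ t := hP₂ ▸ subset_biUnion_of_mem id hb
      exact disjoint_sdiff.mono_right this
    · rw [biUnion_insert, hP₂]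
      exact union_sdiff_of_subset hts
    · intro b hb
      rcases mem_insert.1 hb with rfl | hb
      · exact ⟨ht, htc⟩
      · exact hP₃ b hb

/-- A bound for the size of minimal families of vectors with zero sum, where the vectors have `d`
integer entries between `-Δ` and `Δ`. -/
def bound : ℕ → ℕ → ℕ
  | 0, _ => 1
  | d + 1, Δ => (2 * Δ + 1) * bound d (Δ * (2 * Δ + 1))

/-- Induction on the dimension. The family is partitioned into blocks of at most 2Δ + 1 vectors that
vanish in the first coordinate. The block sums then form a zero-sum family in one dimension less,
with entries at most Δ(2Δ + 1), and the block of `i₀` becomes the distinguished index. -/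
theorem exists_subset (d : ℕ) : ∀ {ι : Type u} [DecidableEq ι] {Δ : ℕ} {s : Finset ι}
    {f : ι → Fin d → ℤ}, (∀ i ∈ s, ∀ j, |f i j| ≤ Δ) → (∀ j, ∑ i ∈ s, f i j = 0) → ∀ i₀ ∈ s,
    ∃ t ⊆ s, i₀ ∈ t ∧ (∀ j, ∑ i ∈ t, f i j = 0) ∧ #t ≤ bound d Δ := by
  induction d with
  | zero =>
    intro ι _ Δ s f _ _ i₀ hi₀
    exact ⟨{i₀}, by simpa using hi₀, by simp, fun j => j.elim0, by simp [bound]⟩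
  | succ d ih =>
    intro ι _ Δ s f hf hs i₀ hi₀
    obtain ⟨P, hP₁, hP₂, hP₃⟩ := exists_partition s (fun i hi => hf i hi 0) (hs 0)
    obtain ⟨b₀, hb₀, hib₀⟩ : ∃ b ∈ P, i₀ ∈ b := by
      rw [← hP₂] at hi₀
      simpa using hi₀
    have hsub : ∀ b ∈ P, b ⊆ s := fun b hb => hP₂ ▸ subset_biUnion_of_mem id hb
    obtain ⟨Q, hQP, hbQ, hQ, hQc⟩ := ih (ι := Finset ι) (Δ := Δ * (2 * Δ + 1)) (s := P)
      (f := fun b j => ∑ i ∈ b, f i j.succ) (fun b hb j => by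
        refine (abs_sum_le_sum_abs _ _).trans ((sum_le_card_nsmul b _ (Δ : ℤ) fun i hi =>
          hf i (hsub b hb hi) _).trans ?_)
        have := (hP₃ b hb).2
        rw [nsmul_eq_mul, mul_comm]
        push_cast
        gcongr
        exact_mod_cast this) (fun j => by
        rw [← hs j.succ, ← hP₂, sum_biUnion hP₁]
        rfl) b₀ hb₀
    refine ⟨Q.biUnion id, hP₂ ▸ biUnion_subset_biUnion_of_subset_left _ hQP,
      mem_biUnion.2 ⟨b₀, hbQ, hib₀⟩, fun j => ?_, ?_⟩
    · rw [sum_biUnion (hP₁.subset (by exact_mod_cast hQP))]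
      refine Fin.cases ?_ (fun j => hQ j) j
      exact sum_eq_zero fun b hb => (hP₃ b (hQP hb)).1
    · refine card_biUnion_le.trans ((sum_le_card_nsmul Q _ (2 * Δ + 1) fun b hb =>
        (hP₃ b (hQP hb)).2).trans ?_)
      rw [smul_eq_mul, bound, mul_comm]
      exact Nat.mul_le_mul_left _ hQc

end ZeroSum

/-! ### Walks in directed multigraphs -/

namespace Multigraph

open Function

variable {V E : Type*} {src tgt : E → V}

/-- The list `p` of edges is a walk from `u` to `v`. -/
def Walk (src tgt : E → V) : V → List E → V → Prop
  | u, [], v => u = v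
  | u, e :: p, v => src e = u ∧ Walk src tgt (tgt e) p v

theorem walk_append {u v : V} {p q : List E} :
    Walk src tgt u (p ++ q) v ↔ ∃ w, Walk src tgt u p w ∧ Walk src tgt w q v := by
  induction p generalizing u with
  | nil => simp [Walk]
  | cons e p ih => simp [Walk, ih, and_assoc]

theorem Walk.split {u v w : V} {p : List E} (h : Walk src tgt u p w) (hv : v ∈ p.map src) :
    ∃ p₁ p₂, p = p₁ ++ p₂ ∧ Walk src tgt u p₁ v ∧ Walk src tgt v p₂ w := by
  obtain ⟨e, he, rfl⟩ := List.mem_map.1 hv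
  obtain ⟨p₁, p₂, rfl⟩ := List.append_of_mem he
  obtain ⟨x, h₁, h₂⟩ := walk_append.1 h
  obtain rfl : src e = x := h₂.1
  exact ⟨p₁, _, rfl, h₁, h₂⟩

/-- A closed walk can be inserted into a walk that it meets. -/
theorem Walk.insert {u v w x : V} {p c : List E} (hp : Walk src tgt u p w)
    (hc : Walk src tgt x c x) (hvp : v ∈ p.map src) (hvc : v ∈ c.map src) :
    ∃ p', p'.Perm (p ++ c) ∧ Walk src tgt u p' w := by
  obtain ⟨p₁, p₂, rfl, h₁, h₂⟩ := hp.split hvp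
  obtain ⟨c₁, c₂, rfl, h₃, h₄⟩ := hc.split hvc
  refine ⟨p₁ ++ (c₂ ++ c₁ ++ p₂), ?_, ?_⟩
  · rw [List.append_assoc p₁]
    refine List.Perm.append_left _ (List.perm_append_comm.trans ?_)
    exact List.Perm.append_left _ List.perm_append_comm
  · exact walk_append.2 ⟨v, h₁, walk_append.2 ⟨v, walk_append.2 ⟨x, h₄, h₃⟩, h₂⟩⟩

/-- Along a closed walk, each target is the source of some edge. -/
theorem Walk.tgt_mem {u w : V} {p : List E} (h : Walk src tgt u p w) {e : E} (he : e ∈ p) :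
    tgt e ∈ p.map src ∨ tgt e = w := by
  obtain ⟨p₁, p₂, rfl⟩ := List.append_of_mem he
  obtain ⟨x, -, h₂⟩ := walk_append.1 h
  obtain ⟨-, h₃⟩ := h₂
  rcases p₂ with _ | ⟨e', p₂⟩
  · exact .inr h₃
  · left
    simp [← h₃.1]

theorem Walk.tgt_mem_of_closed {u : V} {p : List E} (h : Walk src tgt u p u) {e : E}
    (he : e ∈ p) : tgt e ∈ p.map src := by
  refine (h.tgt_mem he).elim id fun h' => ?_
  rcases p with _ | ⟨e', p⟩
  · simp at he
  · simp [h', h.1]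

open Classical in
/-- Starting with a closed walk and cycles whose union is connected, absorb cycles into the walk
until it meets all the remaining ones. -/
theorem exists_absorb {N : ℕ} {u : V} (C : List (List E)) : ∀ A : List E, A ≠ [] →
    Walk src tgt u A u → A.length ≤ N * (A.map src).toFinset.card →
    (∀ c ∈ C, c ≠ [] ∧ c.length ≤ N ∧ ∃ x, Walk src tgt x c x) →
    (∀ e, e ∈ A ∨ (∃ c ∈ C, e ∈ c) →
      Relation.ReflTransGen (fun v w => ∃ e, (e ∈ A ∨ ∃ c ∈ C, e ∈ c) ∧ src e = v ∧ tgt e = w)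
        u (src e)) →
    ∃ (A' : List E) (C' : List (List E)), A' ≠ [] ∧ Walk src tgt u A' u ∧
      A'.length ≤ N * (A'.map src).toFinset.card ∧
      (A' ++ C'.flatten).Perm (A ++ C.flatten) ∧
      ∀ c ∈ C', c.length ≤ N ∧ ∃ x, Walk src tgt x c x ∧ ∃ v ∈ c.map src, v ∈ A'.map src := by
  induction hn : C.length generalizing C with
  | zero =>
    intro A hne hA hAN hC _
    rw [List.length_eq_zero_iff] at hn
    subst hn
    exact ⟨A, [], hne, hA, hAN, .refl _, by simp⟩
  | succ n ih =>
    intro A hne hA hAN hC hconn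
    -- Only cycles that meet the walk and also contain a vertex not yet on it are absorbed.
    by_cases hex : ∃ c ∈ C, (∃ v ∈ c.map src, v ∈ A.map src) ∧ ∃ v ∈ c.map src, v ∉ A.map src
    · obtain ⟨c, hcC, ⟨v, hvc, hvA⟩, w, hwc, hwA⟩ := hex
      obtain ⟨-, hcN, x, hcx⟩ := hC c hcC
      obtain ⟨A', hperm, hA'⟩ := hA.insert hcx hvA hvc
      have hmem : ∀ e, (e ∈ A' ∨ ∃ c' ∈ C.erase c, e ∈ c') ↔ (e ∈ A ∨ ∃ c ∈ C, e ∈ c) := by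
        intro e
        rw [hperm.mem_iff, List.mem_append]
        constructor
        · rintro ((h | h) | ⟨c', hc', h⟩)
          · exact .inl h
          · exact .inr ⟨c, hcC, h⟩
          · exact .inr ⟨c', List.mem_of_mem_erase hc', h⟩
        · rintro (h | ⟨c', hc', h⟩)
          · exact .inl (.inl h)
          · rcases List.mem_cons.1 ((List.perm_cons_erase hcC).mem_iff.1 hc') with rfl | hc'
            · exact .inl (.inr h)
            · exact .inr ⟨c', hc', h⟩
      -- At most `N` edges were added, and at least one new vertex pays for them.
      have hAN' : A'.length ≤ N * (A'.map src).toFinset.card := by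
          have hlt : (A.map src).toFinset.card < (A'.map src).toFinset.card := by
            refine Finset.card_lt_card (Finset.ssubset_iff_subset_ne.2 ⟨fun y hy => ?_, fun h => ?_⟩)
            · rw [List.mem_toFinset] at hy ⊢
              rw [(hperm.map src).mem_iff, List.map_append, List.mem_append]
              exact .inl hy
            · apply hwA
              rw [← List.mem_toFinset, h, List.mem_toFinset, (hperm.map src).mem_iff,
                List.map_append, List.mem_append]
              exact .inr hwc
          rw [hperm.length_eq, List.length_append]
          have := Nat.mul_le_mul_left N hlt
          rw [Nat.mul_succ] at this
          omega
      obtain ⟨A'', C'', h₀, h₁, h₂, h₃, h₄⟩ := ih (C.erase c)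
        (by rw [List.length_erase_of_mem hcC, hn]; rfl) A'
        (fun h => by
          have := hperm.length_eq
          rw [h, List.length_nil, List.length_append] at this
          exact hne (List.length_eq_zero_iff.1 (by omega))) hA' hAN'
        (fun c' hc' => hC c' (List.mem_of_mem_erase hc')) (by simpa only [hmem] using hconn)
      refine ⟨A'', C'', h₀, h₁, h₂, h₃.trans ((hperm.append_right _).trans ?_), h₄⟩
      rw [List.append_assoc, ← List.flatten_cons]
      exact (List.perm_cons_erase hcC).symm.flatten.append_left _
    · push Not at hex
      -- When no such cycle is left, no edge leaves the vertex set of the walk; by connectivity the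
      -- walk visits every source, so it meets all cycles.
      have hclosed : ∀ e, (e ∈ A ∨ ∃ c ∈ C, e ∈ c) → src e ∈ A.map src → tgt e ∈ A.map src := by
        rintro e (he | ⟨c, hc, he⟩) hsrc
        · exact hA.tgt_mem_of_closed he
        · obtain ⟨-, -, x, hx⟩ := hC c hc
          exact hex c hc ⟨_, List.mem_map_of_mem he, hsrc⟩ _ (hx.tgt_mem_of_closed he)
      have hu : u ∈ A.map src := by
        rcases A with _ | ⟨e, A⟩
        · exact (hne rfl).elim
        · simp [← hA.1]
      have hall : ∀ v, Relation.ReflTransGen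
          (fun v w => ∃ e, (e ∈ A ∨ ∃ c ∈ C, e ∈ c) ∧ src e = v ∧ tgt e = w) u v →
          v ∈ A.map src := by
        intro v hv
        induction hv with
        | refl => exact hu
        | tail _ h ih =>
          obtain ⟨e, he, rfl, rfl⟩ := h
          exact hclosed e he ih
      refine ⟨A, C, hne, hA, hAN, .refl _, fun c hc => ?_⟩
      obtain ⟨hc₀, hcN, x, hx⟩ := hC c hc
      obtain ⟨e, he⟩ := List.exists_mem_of_ne_nil c hc₀
      exact ⟨hcN, x, hx, src e, List.mem_map_of_mem he, hall _ (hconn e (.inr ⟨c, hc, he⟩))⟩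

/-! ### Decomposition of balanced multisets of edges into cycles -/

variable [Fintype V]

/-- A nonempty balanced multiset of edges contains a simple cycle. -/
theorem exists_cycle {D : Multiset E} (hD : D.map src = D.map tgt) (hne : D ≠ 0) :
    ∃ c : List E, c ≠ [] ∧ (c : Multiset E) ≤ D ∧ c.length ≤ Fintype.card V ∧
      ∃ x, Walk src tgt x c x := by
  classical
  obtain ⟨e₀, he₀⟩ := Multiset.exists_mem_of_ne_zero hne
  -- One outgoing edge is fixed at each vertex that has one; elsewhere `e₀` is a dummy. By balance,
  -- following these edges never gets stuck.
  have hnext : ∀ v : V, ∃ e : E, v ∈ D.map src → e ∈ D ∧ src e = v := by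
    intro v
    by_cases h : v ∈ D.map src
    · obtain ⟨e, he, h'⟩ := Multiset.mem_map.1 h
      exact ⟨e, fun _ => ⟨he, h'⟩⟩
    · exact ⟨e₀, fun h' => (h h').elim⟩
  choose next hnext using hnext
  have hmem : ∀ v ∈ D.map src, tgt (next v) ∈ D.map src := fun v hv => by
    rw [hD]
    exact Multiset.mem_map_of_mem _ (hnext v hv).1
  set f : V → V := fun v => tgt (next v)
  have hiter : ∀ v ∈ D.map src, ∀ k, f^[k] v ∈ D.map src := by
    intro v hv k
    induction k with
    | zero => exact hv
    | succ k ih =>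
      rw [iterate_succ_apply']
      exact hmem _ ih
  obtain ⟨m, n, hmn, he⟩ := Finite.exists_ne_map_eq_of_infinite fun k => f^[k] (src e₀)
  wlog hlt : m < n generalizing m n
  · exact this n m hmn.symm he.symm (by omega)
  set x := f^[m] (src e₀) with hx
  have hxD : x ∈ D.map src := hiter _ (Multiset.mem_map_of_mem _ he₀) m
  have hper : IsPeriodicPt f (n - m) x := by
    rw [IsPeriodicPt, IsFixedPt, hx, ← iterate_add_apply, Nat.sub_add_cancel hlt.le]
    exact he.symm
  -- The cycle is the orbit of a periodic vertex; taking the minimal period makes its vertices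
  -- distinct.
  have hpos : 0 < minimalPeriod f x := hper.minimalPeriod_pos (by omega)
  set c := (List.range (minimalPeriod f x)).map fun k => next (f^[k] x) with hc
  have hsrc : c.map src = (List.range (minimalPeriod f x)).map fun k => f^[k] x := by
    rw [hc, List.map_map]
    exact List.map_congr_left fun k _ => (hnext _ (hiter x hxD k)).2
  have hnodup : (c.map src).Nodup := by
    rw [hsrc]
    refine List.Nodup.map_on (fun i hi j hj hij => ?_) List.nodup_range
    rw [List.mem_range] at hi hj
    exact iterate_injOn_Iio_minimalPeriod hi hj hij
  have hwalk : ∀ n, Walk src tgt x ((List.range n).map fun k => next (f^[k] x)) (f^[n] x) := by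
    intro n
    induction n with
    | zero => exact rfl
    | succ n ih =>
      rw [List.range_succ, List.map_append]
      refine walk_append.2 ⟨_, ih, (hnext _ (hiter x hxD n)).2, ?_⟩
      rw [iterate_succ_apply']
      exact rfl
  refine ⟨c, ?_, ?_, ?_, x, ?_⟩
  · intro h
    have := congrArg List.length h
    simp [hc] at this
    omega
  -- No edge of the cycle is repeated, so membership in `D` is enough for multiset inclusion.
  · refine (Multiset.le_iff_subset (Multiset.coe_nodup.2 (List.Nodup.of_map src hnodup))).2
      fun e he => ?_
    obtain ⟨k, -, rfl⟩ := List.mem_map.1 (Multiset.mem_coe.1 he)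
    exact (hnext _ (hiter x hxD k)).1
  · simpa using hnodup.length_le_card
  · have h := hwalk (minimalPeriod f x)
    rwa [iterate_minimalPeriod] at h

/-- A balanced multiset of edges is a sum of simple cycles. -/
theorem exists_cycles {D : Multiset E} (hD : D.map src = D.map tgt) :
    ∃ C : List (List E), (C.flatten : Multiset E) = D ∧
      ∀ c ∈ C, c ≠ [] ∧ c.length ≤ Fintype.card V ∧ ∃ x, Walk src tgt x c x := by
  classical
  induction hn : D.card using Nat.strong_induction_on generalizing D with
  | _ n ih =>
    subst hn
    by_cases hne : D = 0
    · exact ⟨[], by simp [hne]⟩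
    obtain ⟨c, hc, hcD, hlen, x, hx⟩ := exists_cycle hD hne
    obtain ⟨D', rfl⟩ := Multiset.le_iff_exists_add.1 hcD
    -- For a closed walk the two ends cancel, so removing a cycle preserves balance.
    have hbal : ∀ {u w : V} {c : List E}, Walk src tgt u c w →
        w ::ₘ (c.map src : Multiset V) = u ::ₘ (c.map tgt : Multiset V) := by
      intro u w c h
      induction c generalizing u with
      | nil => simp [show u = w from h]
      | cons e c ih =>
        obtain ⟨rfl, h⟩ := h
        have := ih h
        simp only [List.map_cons, ← Multiset.cons_coe]
        rw [Multiset.cons_swap, this]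
    have hD' : D'.map src = D'.map tgt := by
      have h := hbal hx
      rw [Multiset.cons_inj_right] at h
      rw [Multiset.map_add, Multiset.map_add, Multiset.map_coe, Multiset.map_coe, h] at hD
      exact add_left_cancel hD
    obtain ⟨C, hC, hC'⟩ := ih D'.card (by
      have := List.length_pos_iff.2 hc
      simp; omega) hD' rfl
    refine ⟨c :: C, ?_, ?_⟩
    · rw [List.flatten_cons, ← Multiset.coe_add, hC]
    · simp only [List.mem_cons, forall_eq_or_imp]
      exact ⟨⟨hc, hlen, x, hx⟩, hC'⟩

/-- A connected balanced multiset of edges consists of a short closed walk, and of short cycles any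
collection of which can be inserted into this walk. -/
theorem exists_walk_cycles {D : Multiset E} {e₀ : E} (hD : D.map src = D.map tgt) (he₀ : e₀ ∈ D)
    (hconn : ∀ e ∈ D, Relation.ReflTransGen (fun v w => ∃ e ∈ D, src e = v ∧ tgt e = w)
      (src e₀) (src e)) :
    ∃ (A : List E) (n : ℕ) (C : Fin n → List E),
      A.length ≤ Fintype.card V * Fintype.card V ∧ (∀ i, (C i).length ≤ Fintype.card V) ∧
      (A : Multiset E) + ∑ i, (C i : Multiset E) = D ∧
      ∀ t : Finset (Fin n), ∃ p : List E, p ≠ [] ∧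
        (p : Multiset E) = A + ∑ i ∈ t, (C i : Multiset E) ∧ Walk src tgt (src e₀) p (src e₀) := by
  classical
  obtain ⟨C, hCD, hC⟩ := exists_cycles hD
  rw [← hCD, Multiset.mem_coe, List.mem_flatten] at he₀
  obtain ⟨c, hcC, hec⟩ := he₀
  obtain ⟨hc₀, hcN, x, hx⟩ := hC c hcC
  -- The cycle through `e₀` is rotated so as to start at the source of `e₀`; it is the initial walk
  -- for the absorption.
  obtain ⟨c₁, c₂, hc₁₂, hw₁, hw₂⟩ := hx.split (List.mem_map_of_mem (f := src) hec)
  have hperm : (c₂ ++ c₁).Perm c := hc₁₂ ▸ List.perm_append_comm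
  have hperm' : (c₂ ++ c₁ ++ (C.erase c).flatten).Perm C.flatten := by
    refine (hperm.append_right _).trans ?_
    rw [← List.flatten_cons]
    exact (List.perm_cons_erase hcC).symm.flatten
  have hne : c₂ ++ c₁ ≠ [] := fun h => hc₀ (by
    rw [h] at hperm
    exact hperm.symm.eq_nil)
  have hmem : ∀ e, (e ∈ c₂ ++ c₁ ∨ ∃ c' ∈ C.erase c, e ∈ c') ↔ e ∈ D := by
    intro e
    rw [← List.mem_flatten, ← List.mem_append, hperm'.mem_iff, ← hCD, Multiset.mem_coe]
  obtain ⟨A, C', h₀, h₁, h₂, h₃, h₄⟩ := exists_absorb (src := src) (tgt := tgt)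
    (N := Fintype.card V) (u := src e₀) (C.erase c) (c₂ ++ c₁) hne
    (walk_append.2 ⟨x, hw₂, hw₁⟩) (by
      rw [hperm.length_eq]
      refine hcN.trans (Nat.le_mul_of_pos_right _ ?_)
      rw [Finset.card_pos, List.toFinset_nonempty_iff]
      simpa using hne)
    (fun c' hc' => hC c' (List.mem_of_mem_erase hc'))
    (by simpa only [hmem] using hconn)
  refine ⟨A, C'.length, C'.get, ?_, fun i => (h₄ _ (C'.get_mem i)).1, ?_, fun t => ?_⟩
  · exact h₂.trans (Nat.mul_le_mul_left _ (Finset.card_le_univ _))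
  · have hsum : ∑ i, (C'.get i : Multiset E) = (C'.flatten : Multiset E) := by
      have : ∀ L : List (List E), (L.map Multiset.ofList).sum =
          (L.flatten : Multiset E) := by
        intro L
        induction L with
        | nil => rfl
        | cons l L ih => rw [List.map_cons, List.sum_cons, ih, List.flatten_cons, Multiset.coe_add]
      rw [← this, ← List.sum_ofFn]
      congr 1
      exact List.ofFn_getElem_eq_map C' _
    rw [hsum, Multiset.coe_add, ← hCD, Multiset.coe_eq_coe]
    exact h₃.trans hperm'
  -- Each cycle meets the core walk `A`, whose edges all survive earlier insertions, so the order of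
  -- insertion is irrelevant.
  · induction t using Finset.induction_on with
    | empty => exact ⟨A, h₀, by simp, h₁⟩
    | insert i t hi ih =>
      obtain ⟨p, hp₀, hp, hw⟩ := ih
      obtain ⟨-, y, hy, v, hvc, hvA⟩ := h₄ _ (C'.get_mem i)
      have hvp : v ∈ p.map src := by
        obtain ⟨e, he, rfl⟩ := List.mem_map.1 hvA
        refine List.mem_map_of_mem ?_
        rw [← Multiset.mem_coe, hp, Multiset.mem_add]
        exact .inl he
      obtain ⟨p', hp', hw'⟩ := hw.insert hy hvp hvc
      refine ⟨p', fun h => hp₀ ?_, ?_, hw'⟩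
      · rw [h] at hp'
        exact (List.append_eq_nil_iff.1 hp'.symm.eq_nil).1
      rw [Multiset.coe_eq_coe.2 hp', ← Multiset.coe_add, hp, Finset.sum_insert hi]
      abel

end Multigraph

/-! ### Runs of regular commutative grammars as walks -/

namespace CommGrammar

open Multigraph

variable {A S : Type}

/-- The state that a transition of a regular grammar produces, if any. -/
noncomputable def nextState (τ : CommTransition A S) : Option S := τ.target.toList.head?

theorem target_eq_of_card_le {τ : CommTransition A S} (h : τ.target.card ≤ 1) :
    (τ.target = 0 ∧ nextState τ = none) ∨ ∃ s, τ.target = {s} ∧ nextState τ = some s := by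
  rcases Nat.le_one_iff_eq_zero_or_eq_one.1 h with h | h
  · left
    rw [Multiset.card_eq_zero] at h
    simp [nextState, h]
  · right
    obtain ⟨s, hs⟩ := Multiset.card_eq_one.1 h
    exact ⟨s, by simp [nextState, hs]⟩

/-- The transitions in the list `p` lead from `u` to `v`, where the end of a run is `none`. -/
def IsPath (u : Option S) (p : List (CommTransition A S)) (v : Option S) : Prop :=
  Walk (fun τ : CommTransition A S => some τ.source) nextState u p v

/-- Along a path each produced state is consumed by the next transition, and only the initial state
is consumed without being produced. No transition starts at `none`, so the path stops as soon as
nothing is produced. -/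
theorem IsPath.isRun {s : S} {p : List (CommTransition A S)} (hp : IsPath (some s) p none)
    (hr : ∀ τ ∈ p, τ.target.card ≤ 1) :
    ConnectedFrom s (.ofList p) ∧ sourceOf (.ofList p) = targetOf (.ofList p) + {s} := by
  induction p generalizing s with
  | nil => simp [IsPath, Walk] at hp
  | cons τ p ih =>
    obtain ⟨h₁, h₂⟩ := hp
    obtain rfl : τ.source = s := Option.some.inj h₁
    rcases target_eq_of_card_le (hr τ (by simp)) with ⟨ht, hn⟩ | ⟨s', ht, hn⟩
    · rw [hn] at h₂
      rcases p with _ | ⟨τ', p⟩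
      · refine ⟨fun t h => ?_, by simp [sourceOf, targetOf, ht]⟩
        simp only [sourceOf, Multiset.map_coe, List.map_cons, List.map_nil, Multiset.mem_coe,
          List.mem_singleton] at h
        rw [h]
      · simp [Walk] at h₂
    · rw [hn] at h₂
      obtain ⟨ih₁, ih₂⟩ := ih h₂ fun τ' h => hr τ' (by simp [h])
      constructor
      · intro t ht'
        rw [← Multiset.cons_coe, sourceOf, Multiset.map_cons, Multiset.mem_cons] at ht'
        rcases ht' with rfl | ht'
        · exact .refl
        · refine .head (b := s') ⟨τ, by simp, rfl, by simp [ht]⟩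
            ((ih₁ t ht').lift id ?_)
          rintro x y ⟨σ, hσ, h⟩
          exact ⟨σ, by simp at hσ ⊢; exact .inr hσ, h⟩
      · rw [← Multiset.cons_coe]
        simp only [sourceOf, targetOf, Multiset.map_cons, Multiset.sum_cons, ht] at ih₂ ⊢
        rw [ih₂, ← Multiset.singleton_add]
        abel

/-- The letters produced by an edge of the graph of a grammar. -/
def edgeOut (e : Option (CommTransition A S)) : Multiset A := e.elim 0 CommTransition.out

theorem card_sum_edgeOut_le {D : Multiset (Option (CommTransition A S))}
    (h : ∀ e ∈ D, (edgeOut e).card ≤ 1) : ((D.map edgeOut).sum).card ≤ D.card := by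
  induction D using Multiset.induction_on with
  | empty => simp
  | cons e D ih =>
    have h₁ := h e (by simp)
    have h₂ := ih fun e he => h e (by simp [he])
    simp
    omega

theorem targetOf_cons (τ : CommTransition A S) (D : Multiset (CommTransition A S)) :
    targetOf (τ ::ₘ D) = τ.target + targetOf D := by
  simp [targetOf]

/-- The number `k` counts the transitions that produce no state; they are the edges into the vertex
`none`. -/
theorem exists_map_nextState {D : Multiset (CommTransition A S)}
    (h : ∀ τ ∈ D, τ.target.card ≤ 1) :
    ∃ k, D.map nextState = (targetOf D).map some + Multiset.replicate k none := by
  induction D using Multiset.induction_on with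
  | empty => exact ⟨0, by simp [targetOf]⟩
  | cons τ D ih =>
    obtain ⟨k, hk⟩ := ih fun τ hτ => h τ (by simp [hτ])
    rcases target_eq_of_card_le (h τ (by simp)) with ⟨ht, hn⟩ | ⟨s', ht, hn⟩
    · refine ⟨k + 1, ?_⟩
      rw [Multiset.map_cons, hk, hn, targetOf_cons, ht, zero_add, Multiset.replicate_succ,
        Multiset.add_cons]
    · refine ⟨k, ?_⟩
      rw [Multiset.map_cons, hk, hn, targetOf_cons, ht, Multiset.map_add, Multiset.map_singleton,
        add_assoc, Multiset.singleton_add]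

theorem exists_eq_map_some {α : Type*} {l : List (Option α)} (h : none ∉ l) :
    ∃ l' : List α, l = l'.map some := by
  induction l with
  | nil => exact ⟨[], rfl⟩
  | cons x l ih =>
    simp only [List.mem_cons, not_or] at h
    obtain ⟨l', rfl⟩ := ih h.2
    obtain ⟨a, rfl⟩ := Option.ne_none_iff_exists'.1 (Ne.symm h.1)
    exact ⟨a :: l', rfl⟩

/-- The sources of the edges of the graph of a grammar, where the edge `none` leads from the end
to the initial state. -/
def edgeSource (e : Option (CommTransition A S)) : Option S := e.map CommTransition.source

/-- The targets of the edges of the graph of a grammar. -/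
noncomputable def edgeTarget (s : S) (e : Option (CommTransition A S)) : Option S :=
  e.elim (some s) nextState

theorem isPath_of_walk {s : S} {u v : Option S} {p : List (CommTransition A S)}
    (h : Walk edgeSource (edgeTarget s) u (p.map some) v) : IsPath u p v := by
  induction p generalizing u with
  | nil => exact h
  | cons τ p ih => exact ⟨h.1, ih h.2⟩

/-- Each output of a regular grammar is the sum of the outputs of a short path and of short cycles,
any collection of which may be left out. -/
theorem exists_decomposition [Fintype S] {G : CommGrammar A S} (hG : G.IsRegular)
    {v : Multiset A} (hv : v ∈ G.outputs) {N : ℕ} (hN : Fintype.card S + 1 ≤ N) :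
    ∃ (a : Multiset A) (n : ℕ) (c : Fin n → Multiset A), a.card ≤ N * N ∧ (∀ i, (c i).card ≤ N) ∧
      a + ∑ i, c i = v ∧ ∀ t : Finset (Fin n), ∃ p : List (CommTransition A S),
        IsPath (some G.init) p none ∧ (∀ τ ∈ p, τ ∈ G.transitions) ∧
        outOf (.ofList p) = a + ∑ i ∈ t, c i ∧ p.length ≤ N * N + N * t.card := by
  classical
  obtain ⟨D, ⟨hD₁, hD₂, hD₃⟩, rfl⟩ := hv
  have hcard : ∀ τ ∈ D, τ.target.card ≤ 1 := fun τ hτ => hG τ (hD₁ τ hτ)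
  obtain ⟨k, hk⟩ := exists_map_nextState hcard
  -- Counting both sides of the run equation: exactly one transition of a run of a regular grammar
  -- is terminating.
  have hk₁ : k = 1 := by
    have h₁ := congrArg Multiset.card hk
    have h₂ := congrArg Multiset.card hD₃
    simp [sourceOf] at h₁ h₂
    omega
  subst hk₁
  -- The added edge `none` returns from the end to the initial state and so balances the run.
  set E : Multiset (Option (CommTransition A S)) := none ::ₘ D.map some with hE
  have hbal : E.map edgeSource = E.map (edgeTarget G.init) := by
    have h₁ : (D.map some).map edgeSource = (sourceOf D).map some := by
      simp [sourceOf, edgeSource, Function.comp_def]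
    have h₂ : (D.map some).map (edgeTarget G.init) = D.map nextState := by
      simp [edgeTarget, Function.comp_def]
    rw [hE, Multiset.map_cons, Multiset.map_cons, h₁, h₂, hk, hD₃]
    simp only [edgeSource, edgeTarget, Multiset.map_add, Multiset.map_singleton,
      Multiset.replicate_one, Option.map_none, Option.elim_none, ← Multiset.singleton_add]
    abel
  have hconn : ∀ e ∈ E, Relation.ReflTransGen
      (fun v w => ∃ e ∈ E, edgeSource e = v ∧ edgeTarget G.init e = w)
      (edgeSource (none : Option (CommTransition A S))) (edgeSource e) := by
    intro e he
    rcases Multiset.mem_cons.1 he with rfl | he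
    · exact .refl
    obtain ⟨τ, hτ, rfl⟩ := Multiset.mem_map.1 he
    refine .head ⟨none, by simp [E], rfl, rfl⟩ ?_
    refine (hD₂ τ.source (Multiset.mem_map_of_mem _ hτ)).lift some ?_
    rintro x y ⟨σ, hσ, rfl, hy⟩
    refine ⟨some σ, by simp [E, hσ], rfl, ?_⟩
    rcases target_eq_of_card_le (hcard σ hσ) with ⟨ht, -⟩ | ⟨s', ht, hn⟩
    · simp [ht] at hy
    · rw [ht, Multiset.mem_singleton] at hy
      simp [edgeTarget, hn, hy]
  obtain ⟨B, n, C, hB, hC, hBC, hw⟩ := exists_walk_cycles hbal (by simp [E]) hconn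
  rw [Fintype.card_option] at hB hC
  have hout : ∀ e ∈ E, (edgeOut e).card ≤ 1 := by
    intro e he
    rcases Multiset.mem_cons.1 he with rfl | he
    · simp [edgeOut]
    obtain ⟨τ, hτ, rfl⟩ := Multiset.mem_map.1 he
    exact G.card_out_le τ (hD₁ τ hτ)
  have hBE : (B : Multiset (Option (CommTransition A S))) ≤ E := hBC ▸ Multiset.le_add_right _ _
  have hCE : ∀ t : Finset (Fin n), ∑ i ∈ t, (C i : Multiset (Option (CommTransition A S))) ≤
      ∑ i, (C i : Multiset (Option (CommTransition A S))) := fun t =>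
    Finset.sum_le_sum_of_subset (Finset.subset_univ t)
  have hmap : ∀ t : Finset (Fin n), ((∑ i ∈ t, (C i : Multiset (Option (CommTransition A S)))).map edgeOut).sum =
      ∑ i ∈ t, ((C i : Multiset (Option (CommTransition A S))).map edgeOut).sum := by
    intro t
    induction t using Finset.induction_on with
    | empty => simp
    | insert i t hi ih =>
      rw [Finset.sum_insert hi, Multiset.map_add, Multiset.sum_add, ih, Finset.sum_insert hi]
  refine ⟨((B : Multiset (Option (CommTransition A S))).map edgeOut).sum, n, fun i => ((C i : Multiset (Option (CommTransition A S))).map edgeOut).sum,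
    ?_, fun i => ?_, ?_, fun t => ?_⟩
  · refine (card_sum_edgeOut_le fun e he => hout e (Multiset.mem_of_le hBE he)).trans ?_
    rw [Multiset.coe_card]
    exact hB.trans (Nat.mul_le_mul hN hN)
  · refine (card_sum_edgeOut_le fun e he => hout e ?_).trans ?_
    · rw [← hBC]
      refine Multiset.mem_add.2 (.inr (Multiset.mem_of_le (hCE {i}) (by simpa using he)))
    · rw [Multiset.coe_card]
      exact (hC i).trans hN
  · rw [← hmap, ← Multiset.sum_add, ← Multiset.map_add, hBC, hE]
    simp [edgeOut, outOf, Function.comp_def]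
  · obtain ⟨p, hp₀, hp, hpw⟩ := hw t
    have hpE : (.ofList p) ≤ E := by
      rw [hp, ← hBC]
      exact add_le_add_right (hCE t) _
    rcases p with _ | ⟨e, q⟩
    · exact (hp₀ rfl).elim
    -- Transitions start at proper states, so a walk from the end begins with the return edge.
    obtain rfl : e = none := by
      have := hpw.1
      simpa [edgeSource] using this
    -- The return edge occurs only once in `E`, so the rest of the walk is a path of transitions.
    have hq : none ∉ q := by
      rw [hE, ← Multiset.cons_coe, Multiset.cons_le_cons_iff] at hpE
      intro h
      have := Multiset.mem_of_le hpE (Multiset.mem_coe.2 h)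
      simp at this
    obtain ⟨r, rfl⟩ := exists_eq_map_some hq
    refine ⟨r, isPath_of_walk hpw.2, fun τ hτ => hD₁ τ ?_, ?_, ?_⟩
    · rw [hE, ← Multiset.cons_coe, Multiset.cons_le_cons_iff] at hpE
      have := Multiset.mem_of_le hpE (a := some τ) (by simpa using hτ)
      simpa using this
    · have := congrArg (fun D => (D.map edgeOut).sum) hp
      rw [← hmap, ← Multiset.sum_add, ← Multiset.map_add, ← hp, ← Multiset.cons_coe]
      simp [edgeOut, outOf, Function.comp_def]
    · have h₁ := congrArg Multiset.card hp
      have h₂ : (∑ i ∈ t, (C i : Multiset (Option (CommTransition A S)))).card ≤ t.card * N := by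
        rw [Multiset.card_sum]
        exact Finset.sum_le_card_nsmul _ _ _ fun i _ => (hC i).trans hN
      have h₃ := Nat.mul_le_mul hN hN
      simp only [Multiset.coe_card, Multiset.card_add, List.length_cons, List.length_map] at h₁
      rw [Nat.mul_comm N t.card]
      omega

/-- A bound for the length of the shortest paths that witness that the outputs of two regular
grammars with less than `N` states intersect. -/
def pathBound (d N : ℕ) : ℕ := N * N + N * ZeroSum.bound d (N * N)

/-- If the outputs of two regular grammars intersect, then this is witnessed by short paths. -/
theorem exists_short_paths {d m n : ℕ} {G : CommGrammar (Fin d) (Fin m)}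
    {H : CommGrammar (Fin d) (Fin n)} (hG : G.IsRegular) (hH : H.IsRegular) {N : ℕ}
    (hm : m + 1 ≤ N) (hn : n + 1 ≤ N) (h : (G.outputs ∩ H.outputs).Nonempty) :
    ∃ p q, IsPath (some G.init) p none ∧ (∀ τ ∈ p, τ ∈ G.transitions) ∧
      IsPath (some H.init) q none ∧ (∀ τ ∈ q, τ ∈ H.transitions) ∧
      p.length ≤ pathBound d N ∧ q.length ≤ pathBound d N ∧ outOf (.ofList p) = outOf (.ofList q) := by
  classical
  obtain ⟨v, hvG, hvH⟩ := h
  obtain ⟨a, k, c, ha, hc, hac, hp⟩ := exists_decomposition hG hvG (N := N) (by simpa using hm)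
  obtain ⟨b, l, e, hb, he, hbe, hq⟩ := exists_decomposition hH hvH (N := N) (by simpa using hn)
  have hN : N ≤ N * N := Nat.le_mul_of_pos_left N (by omega)
  have hcount : ∀ {x : Multiset (Fin d)} {j}, x.card ≤ N * N → (x.count j : ℤ) ≤ (N * N : ℕ) :=
    fun {x j} hx => by exact_mod_cast (Multiset.count_le_card j x).trans hx
  -- The index `none` stands for the difference of the two core outputs; the cycles of the second
  -- grammar count negatively.
  let f : Option (Fin k ⊕ Fin l) → Fin d → ℤ
    | none => fun j => a.count j - b.count j
    | some (.inl i) => fun j => (c i).count j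
    | some (.inr i) => fun j => -(e i).count j
  have hf : ∀ i ∈ (Finset.univ : Finset (Option (Fin k ⊕ Fin l))), ∀ j, |f i j| ≤ (N * N : ℕ) := by
    rintro (_ | i | i) - j
    · have h₁ := hcount (j := j) ha
      have h₂ := hcount (j := j) hb
      simp only [f, abs_le]
      omega
    · have h₁ := hcount (j := j) ((hc i).trans hN)
      simp only [f, abs_le]
      omega
    · have h₁ := hcount (j := j) ((he i).trans hN)
      simp only [f, abs_le]
      omega
  have hsum : ∀ (t : Finset (Fin k)) (t' : Finset (Fin l)) (j : Fin d),
      ((a + ∑ i ∈ t, c i).count j : ℤ) - (b + ∑ i ∈ t', e i).count j =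
        ∑ i ∈ insert none ((t.disjSum t').map Function.Embedding.some), f i j := by
    intro t t' j
    rw [Finset.sum_insert (by simp), Finset.sum_map, Finset.sum_disjSum]
    simp only [f, Function.Embedding.some_apply, Multiset.count_add, Multiset.count_sum',
      Finset.sum_neg_distrib]
    push_cast
    ring
  have hset : ∀ s : Finset (Option (Fin k ⊕ Fin l)), none ∈ s → s =
      insert none (((s.eraseNone.toLeft).disjSum (s.eraseNone.toRight)).map
        Function.Embedding.some) := by
    intro s hs
    ext x
    rcases x with _ | i | i <;> simp [hs]
  have hzero : ∀ j, ∑ i ∈ (Finset.univ : Finset (Option (Fin k ⊕ Fin l))), f i j = 0 := by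
    intro j
    have h₁ : (Finset.univ : Finset (Option (Fin k ⊕ Fin l))) = insert none
        (((Finset.univ : Finset (Fin k)).disjSum (Finset.univ : Finset (Fin l))).map
          Function.Embedding.some) := by
      ext x
      rcases x with _ | i | i <;> simp
    rw [h₁, ← hsum, hac, hbe, sub_self]
  -- The subfamily has to contain `none`, since the core walks cannot be left out.
  obtain ⟨s, -, hs, hs₀, hsc⟩ := ZeroSum.exists_subset d hf hzero none (Finset.mem_univ _)
  obtain ⟨p, hp₁, hp₂, hp₃, hp₄⟩ := hp s.eraseNone.toLeft
  obtain ⟨q, hq₁, hq₂, hq₃, hq₄⟩ := hq s.eraseNone.toRight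
  have hcard := congrArg Finset.card (hset s hs)
  rw [Finset.card_insert_of_notMem (by simp), Finset.card_map, Finset.card_disjSum] at hcard
  have hlen : ∀ {r x : ℕ}, r ≤ N * N + N * x → x ≤ s.card → r ≤ pathBound d N :=
    fun {r x} hr hx => hr.trans (Nat.add_le_add_left (Nat.mul_le_mul_left N (hx.trans hsc)) _)
  refine ⟨p, q, hp₁, hp₂, hq₁, hq₂, hlen hp₄ (by omega), hlen hq₄ (by omega), ?_⟩
  ext j
  have h₁ := hsum s.eraseNone.toLeft s.eraseNone.toRight j
  rw [← hset s hs, hs₀ j] at h₁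
  rw [hp₃, hq₃]
  omega

/-- The outputs of regular grammars are the outputs of paths. -/
theorem IsPath.mem_outputs {G : CommGrammar A S} (hG : G.IsRegular)
    {p : List (CommTransition A S)} (hp : IsPath (some G.init) p none)
    (hpG : ∀ τ ∈ p, τ ∈ G.transitions) : outOf (.ofList p) ∈ G.outputs :=
  ⟨p, ⟨fun τ hτ => hpG τ (by simpa using hτ), hp.isRun fun τ hτ => hG τ (hpG τ hτ)⟩, rfl⟩

end CommGrammar

/-! ### A library of polynomial time functions -/

namespace StackMachine

namespace PolyTime

open TreeCode

variable {α β γ δ : Type} [TreeCode α] [TreeCode β] [TreeCode γ] [TreeCode δ]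

theorem left {f : α → β × γ} (hf : PolyTime f) : PolyTime (fun x => (f x).1) := fst.comp hf

theorem right {f : α → β × γ} (hf : PolyTime f) : PolyTime (fun x => (f x).2) := snd.comp hf

theorem comp₂ {g : α → β → γ} {f : δ → α} {h : δ → β} (hg : PolyTime (fun x : α × β => g x.1 x.2))
    (hf : PolyTime f) (hh : PolyTime h) : PolyTime (fun x => g (f x) (h x)) :=
  hg.comp (hf.pair hh)

theorem and {f g : α → Bool} (hf : PolyTime f) (hg : PolyTime g) :
    PolyTime (fun x => f x && g x) := by
  have h := cond hf hg (const false)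
  convert h using 2 with x
  cases f x <;> rfl

theorem or {f g : α → Bool} (hf : PolyTime f) (hg : PolyTime g) :
    PolyTime (fun x => f x || g x) := by
  have h := cond hf (const true) hg
  convert h using 2 with x
  cases f x <;> rfl

theorem not {f : α → Bool} (hf : PolyTime f) : PolyTime (fun x => !f x) := by
  have h := cond hf (const false) (const true)
  convert h using 2 with x
  cases f x <;> rfl

theorem reverse {f : α → List β} (hf : PolyTime f) : PolyTime (fun x => (f x).reverse) := by
  have h := foldl_of_le (g := fun y : α × List β × β => y.2.2 :: y.2.1) hf (const ([] : List β))
    (cons (snd.comp snd) (fst.comp snd)) (.X + 1) fun x b a _ => by simp; omega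
  convert h using 2 with x
  simp

theorem foldr_of_le {f : δ → List α} {z : δ → β} {g : δ × β × α → β} (hf : PolyTime f)
    (hz : PolyTime z) (hg : PolyTime g) (q : Polynomial ℕ)
    (hq : ∀ x b, ∀ a ∈ f x, size (g (x, b, a)) ≤ size b + q.eval (size x + size a)) :
    PolyTime (fun x => (f x).foldr (fun a b => g (x, b, a)) (z x)) := by
  have h := foldl_of_le hf.reverse hz hg q fun x b a ha => hq x b a (by simpa using ha)
  simpa using h

theorem any {f : δ → List α} {g : δ → α → Bool} (hf : PolyTime f)
    (hg : PolyTime (fun y : δ × α => g y.1 y.2)) :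
    PolyTime (fun x => (f x).any fun a => g x a) := by
  have h := foldr_of_le (g := fun y : δ × Bool × α => g y.1 y.2.2 || y.2.1) hf (const false)
    ((hg.comp (fst.pair (snd.comp snd))).or (fst.comp snd)) 3 fun x b a _ =>
      (size_bool_le _).trans (by simp)
  convert h using 2 with x
  induction f x with
  | nil => rfl
  | cons a l ih => rw [List.any_cons, List.foldr_cons, ← ih]

theorem filter {f : δ → List α} {g : δ → α → Bool} (hf : PolyTime f)
    (hg : PolyTime (fun y : δ × α => g y.1 y.2)) :
    PolyTime (fun x => (f x).filter fun a => g x a) := by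
  have h := foldr_of_le (g := fun y : δ × List α × α =>
    Bool.rec (motive := fun _ => List α) y.2.1 (y.2.2 :: y.2.1) (g y.1 y.2.2)) hf
    (const ([] : List α)) ?_ (.X + 1) fun x b a _ => ?_
  · convert h using 2 with x
    induction f x with
    | nil => rfl
    | cons a l ih =>
      rw [List.foldr_cons, ← ih, List.filter_cons]
      cases g x a <;> simp
  · have h := cond (hg.comp (f := fun y : δ × List α × α => (y.1, y.2.2))
      (fst.pair (snd.comp snd))) (cons (snd.comp snd) (fst.comp snd)) (fst.comp snd)
    convert h using 2 with y
    cases g y.1 y.2.2 <;> rfl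
  · cases g x a <;> (simp; try omega)

theorem map {f : δ → List α} {g : δ → α → β} (hf : PolyTime f)
    (hg : PolyTime (fun y : δ × α => g y.1 y.2)) :
    PolyTime (fun x => (f x).map fun a => g x a) := by
  obtain ⟨p, hp⟩ := hg.size_le
  have h := foldr_of_le (g := fun y : δ × List β × α => g y.1 y.2.2 :: y.2.1) hf
    (const ([] : List β)) (cons (hg.comp (fst.pair (snd.comp snd))) (fst.comp snd))
    (p.comp (.X + 1) + 1) fun x b a _ => by
      have := hp (x, a)
      simp at this ⊢
      omega
  convert h using 2 with x
  induction f x with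
  | nil => rfl
  | cons a l ih => rw [List.map_cons, List.foldr_cons, ← ih]

theorem append {f g : δ → List α} (hf : PolyTime f) (hg : PolyTime g) :
    PolyTime (fun x => f x ++ g x) := by
  have h := foldr_of_le (g := fun y : δ × List α × α => y.2.2 :: y.2.1) hf hg
    (cons (snd.comp snd) (fst.comp snd)) (.X + 1) fun x b a _ => by simp; omega
  convert h using 2 with x
  induction f x with
  | nil => rfl
  | cons a l ih => rw [List.cons_append, List.foldr_cons, ← ih]

theorem flatMap {f : δ → List α} {g : δ → α → List β} (hf : PolyTime f)
    (hg : PolyTime (fun y : δ × α => g y.1 y.2)) :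
    PolyTime (fun x => (f x).flatMap fun a => g x a) := by
  obtain ⟨p, hp⟩ := hg.size_le
  have h := foldr_of_le (g := fun y : δ × List β × α => g y.1 y.2.2 ++ y.2.1) hf
    (const ([] : List β)) (append (hg.comp (fst.pair (snd.comp snd))) (fst.comp snd))
    (p.comp (.X + 1)) fun x b a _ => by
      have h₁ := hp (x, a)
      have h₂ := size_append (g x a) b
      simp at h₁ ⊢
      omega
  convert h using 2 with x
  induction f x with
  | nil => rfl
  | cons a l ih => rw [List.flatMap_cons, List.foldr_cons, ← ih]

theorem replicate_unit {f : δ → ℕ} (hf : PolyTime f) :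
    PolyTime (fun x => List.replicate (f x) ()) :=
  (of_tree_eq (f := fun n : ℕ => List.replicate n ()) fun _ => rfl).comp hf

/-- Replacing all entries by `()` leaves the unary numeral for the length. -/
theorem length {f : δ → List α} (hf : PolyTime f) : PolyTime (fun x => (f x).length) := by
  have h := (of_tree_eq (f := fun l : List Unit => l.length) fun l => by
    change tree (List.replicate l.length ()) = tree l
    congr 1
    exact (List.eq_replicate_of_mem fun _ _ => rfl).symm).comp
      (map (g := fun (_ : δ) (_ : α) => ()) hf (const ()))
  simpa using h

theorem add {f g : δ → ℕ} (hf : PolyTime f) (hg : PolyTime g) :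
    PolyTime (fun x => f x + g x) := by
  have h := (hf.replicate_unit.append hg.replicate_unit).length
  simpa using h

theorem mul {f g : δ → ℕ} (hf : PolyTime f) (hg : PolyTime g) :
    PolyTime (fun x => f x * g x) := by
  obtain ⟨p, hp⟩ := hg.size_le
  have h := foldr_of_le (g := fun y : δ × ℕ × Unit => g y.1 + y.2.1) hf.replicate_unit
    (const 0) ((hg.comp fst).add (fst.comp snd)) p fun x b a _ => by
      have h₁ := (hp x).trans (eval_mono p (Nat.le_add_right (size x) (size a)))
      simp at h₁ ⊢
      omega
  convert h using 2 with x
  induction f x with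
  | zero => simp
  | succ n ih =>
    rw [List.replicate_succ, List.foldr_cons, ← ih]
    simp only
    ring

/-- The exponent is a constant: with numbers in unary, a variable exponent would give values of
exponential size. -/
theorem pow {f : δ → ℕ} (hf : PolyTime f) (k : ℕ) : PolyTime (fun x => f x ^ k) := by
  induction k with
  | zero => simpa using const 1
  | succ k ih => simpa only [pow_succ] using ih.mul hf

end PolyTime

/-- The numbers below `n`. -/
def below (n : ℕ) : List ℕ := (List.replicate n ()).foldl (fun b _ => b.length :: b) []

theorem length_foldl_below (l : List Unit) :
    (l.foldl (fun (b : List ℕ) _ => b.length :: b) []).length = l.length := by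
  induction l using List.reverseRecOn with
  | nil => rfl
  | append_singleton l a ih => simp [ih]

theorem mem_below {n i : ℕ} : i ∈ below n ↔ i < n := by
  induction n with
  | zero => simp [below]
  | succ n ih =>
    rw [below, List.replicate_succ', List.foldl_append, List.foldl_cons, List.foldl_nil,
      List.mem_cons, length_foldl_below, List.length_replicate]
    change i = n ∨ i ∈ below n ↔ _
    rw [ih]
    omega

/-- The growth in one step depends on the accumulator, so `foldl_of_le` does not apply; this
quadratic bound on prefixes serves `foldl` instead. -/
theorem size_foldl_below_le (l : List Unit) :
    size (l.foldl (fun (b : List ℕ) _ => b.length :: b) []) ≤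
      l.length * (2 * l.length + 2) + 1 := by
  induction l using List.reverseRecOn with
  | nil => simp
  | append_singleton l a ih =>
    simp only [List.foldl_append, List.foldl_cons, List.foldl_nil, size_cons, size_nat,
      length_foldl_below, List.length_append, List.length_singleton]
    nlinarith

theorem PolyTime.below {δ : Type} [TreeCode δ] {f : δ → ℕ} (hf : PolyTime f) :
    PolyTime (fun x => below (f x)) := by
  obtain ⟨p, hp⟩ := hf.size_le
  have h := foldl (g := fun y : δ × List ℕ × Unit => y.2.1.length :: y.2.1) hf.replicate_unit
    (const ([] : List ℕ)) (cons (length (fst.comp snd)) (fst.comp snd))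
    (p * (2 * p + 2) + 1) fun x l hl => by
      refine (size_foldl_below_le l).trans ?_
      have h₁ := hl.length_le
      rw [List.length_replicate] at h₁
      have h₂ : l.length ≤ p.eval (size x) := by
        have := hp x
        rw [size_nat] at this
        omega
      simp only [Polynomial.eval_add, Polynomial.eval_mul, Polynomial.eval_one,
        Polynomial.eval_ofNat]
      gcongr
  exact h

end StackMachine

/-! ### The algorithm -/

namespace GrammarSymbol

variable {d : ℕ}

/-- Symbols as pairs of numbers. -/
def toPair : GrammarSymbol d → ℕ × ℕ
  | bit b => (0, b.toNat)
  | letter a => (1, a)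
  | start => (2, 0)
  | rule => (3, 0)
  | target => (4, 0)

theorem toPair_injective : Function.Injective (toPair (d := d)) := by
  rintro (_ | _ | _ | _ | _) (_ | _ | _ | _ | _) h <;> simp [toPair, Fin.ext_iff] at h ⊢
  · rename_i b c
    revert h
    cases b <;> cases c <;> simp
  · exact h

noncomputable instance : Fintype (GrammarSymbol d) :=
  letI := Classical.decEq (GrammarSymbol d)
  Fintype.ofSurjective (α := Bool ⊕ Fin d ⊕ Fin 3)
    (Sum.elim bit (Sum.elim letter ![start, rule, target])) (by
      rintro (b | a | _ | _ | _)
      · exact ⟨.inl b, rfl⟩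
      · exact ⟨.inr (.inl a), rfl⟩
      · exact ⟨.inr (.inr 0), rfl⟩
      · exact ⟨.inr (.inr 1), rfl⟩
      · exact ⟨.inr (.inr 2), rfl⟩)

instance : StackMachine.TreeCode (GrammarSymbol d) where
  tree x := StackMachine.TreeCode.tree x.toPair
  tree_injective := StackMachine.TreeCode.tree_injective.comp toPair_injective

end GrammarSymbol

namespace RawGrammar

open StackMachine PolyTime

/-- A transition: its source, its letters, and its targets. -/
abbrev Rule := List Bool × List ℕ × List (List Bool)

/-- A grammar: its initial state and its transitions. -/
abbrev Raw := List Bool × List Rule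

/-- The memory of the parser: the transition and the list of transitions that are being read, and
the two grammars that were read last. -/
abbrev Memory := Rule × List Rule × Raw × Raw

/-- The empty transition. -/
def emptyRule : Rule := ([], [], [])

/-- The effect of reading a symbol, given as a pair of numbers. The input is read from right to
left. -/
def read (y : ℕ × ℕ) (m : Memory) : Memory :=
  cond (decide (y.1 = 0)) ((decide (y.2 = 1) :: m.1.1, m.1.2), m.2) <|
  cond (decide (y.1 = 1)) ((m.1.1, y.2 :: m.1.2.1, m.1.2.2), m.2) <|
  cond (decide (y.1 = 4)) (([], m.1.2.1, m.1.1 :: m.1.2.2), m.2) <|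
  cond (decide (y.1 = 3)) (emptyRule, m.1 :: m.2.1, m.2.2) <|
  (emptyRule, [], (m.1.1, m.2.1), m.2.2.1)

/-- The parser, on the reversed input. -/
def parse {d : ℕ} (w : List (GrammarSymbol d)) : Memory :=
  w.foldl (fun m x => read x.toPair m) (emptyRule, [], ([], []), ([], []))

theorem polyTime_read : PolyTime (fun x : (ℕ × ℕ) × Memory => read x.1 x.2) := by
  have h (k : ℕ) : PolyTime (fun x : (ℕ × ℕ) × Memory => decide (x.1.1 = k)) :=
    eq id.left.left (const k)
  have m : PolyTime (fun x : (ℕ × ℕ) × Memory => x.2) := snd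
  refine cond (h 0) ?_ (cond (h 1) ?_ (cond (h 4) ?_ (cond (h 3) ?_ ?_)))
  · exact ((cons (eq id.left.right (const 1)) m.left.left).pair m.left.right).pair m.right
  · exact (m.left.left.pair ((cons id.left.right m.left.right.left).pair m.left.right.right)).pair
      m.right
  · exact ((const []).pair (m.left.right.left.pair (cons m.left.left m.left.right.right))).pair
      m.right
  · exact (const _).pair ((cons m.left m.right.left).pair m.right.right)
  · exact (const _).pair ((const []).pair ((m.left.left.pair m.right.left).pair m.right.right.left))

/-- Each branch only rearranges the memory, discards parts of it, or adds the symbol just read and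
some marks. The memory therefore grows linearly. -/
theorem size_read_le (y : ℕ × ℕ) (m : Memory) : size (read y m) ≤ size m + 30 + size y := by
  obtain ⟨⟨b, l, t⟩, r, ⟨G₁, G₂⟩, H₁, H₂⟩ := m
  have := one_le_size b
  have := one_le_size l
  have := one_le_size t
  have := one_le_size r
  have := one_le_size H₁
  have := one_le_size H₂
  have := size_bool_le (decide (y.2 = 1))
  obtain ⟨y₁, y₂⟩ := y
  simp only [read, emptyRule]
  rcases decide (y₁ = 0) <;> rcases decide (y₁ = 1) <;> rcases decide (y₁ = 4) <;>
    rcases decide (y₁ = 3) <;> simp <;> simp at this <;> omega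

theorem polyTime_parse (d : ℕ) : PolyTime (parse (d := d)) := by
  have h₁ : PolyTime (GrammarSymbol.toPair (d := d)) := of_tree_eq fun _ => rfl
  have h₂ : PolyTime (fun y : List (GrammarSymbol d) × Memory × GrammarSymbol d =>
      read y.2.2.toPair y.2.1) :=
    comp₂ (g := read) polyTime_read (comp h₁ id.right.right) id.right.left
  refine foldl_of_le (g := fun y : List (GrammarSymbol d) × Memory × GrammarSymbol d =>
    read y.2.2.toPair y.2.1) id (const (emptyRule, [], ([], []), ([], [])))
    h₂ (.X + 30) fun x b a _ => ?_
  refine (size_read_le a.toPair b).trans ?_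
  have h₃ : size a.toPair = size a := rfl
  rw [h₃, Polynomial.eval_add, Polynomial.eval_X, Polynomial.eval_ofNat]
  generalize size a = s, size b = t, size x = u
  omega

/-! ### Reachability search with a counter -/

/-- The weight of a letter: `M ^ a` for the letter `a < d`. -/
def letterWeight (M : ℕ) : ℕ → ℕ → ℕ
  | 0, _ => 0
  | d + 1, a => cond (decide (a = d)) (M ^ d) (letterWeight M d a)

/-- The weight of a list of letters. -/
def weight (d M : ℕ) (l : List ℕ) : ℕ := l.foldr (fun a b => letterWeight M d a + b) 0

theorem polyTime_letterWeight (d : ℕ) : PolyTime (fun x : ℕ × ℕ => letterWeight x.1 d x.2) := by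
  induction d with
  | zero => exact const 0
  | succ d ih => exact cond (eq snd (const d)) (fst.pow d) ih

theorem polyTime_weight (d : ℕ) : PolyTime (fun x : ℕ × List ℕ => weight d x.1 x.2) := by
  obtain ⟨p, hp⟩ := (polyTime_letterWeight d).size_le
  refine foldr_of_le (g := fun y : (ℕ × List ℕ) × ℕ × ℕ => letterWeight y.1.1 d y.2.2 + y.2.1) snd
    (const 0) (((polyTime_letterWeight d).comp (id.left.left.pair id.right.right)).add
      id.right.left) (p.comp .X) fun x b a _ => ?_
  have h := (hp (x.1, a)).trans (eval_mono p (n := size x + size a) (by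
    obtain ⟨x, l⟩ := x
    simp))
  simp at h ⊢
  omega

/-- A list of states, together with a weight. -/
abbrev Node := List (List Bool) × ℕ

/-- The nodes of the product of the grammar with a counter with values less than `W`. -/
def nodes (G : Raw) (W : ℕ) : List Node :=
  ([G.1] :: G.2.map fun r => r.2.2).flatMap fun t => (below W).map fun i => (t, i)

/-- One step of the search for reachable nodes. -/
def expand (d M : ℕ) (rules : List Rule) (nodes R : List Node) : List Node :=
  nodes.filter fun y => (R.any fun x => decide (x = y)) || rules.any fun r => R.any fun x =>
    decide (x.1 = [r.1]) && (decide (y.1 = r.2.2) && decide (y.2 = x.2 + weight d M r.2.1))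

/-- The nodes that are reachable in `L` steps. -/
def reach (d M W L : ℕ) (G : Raw) : List Node :=
  (List.replicate L ()).foldl (fun R _ => expand d M G.2 (nodes G W) R) [([G.1], 0)]

theorem polyTime_nodes : PolyTime (fun x : Raw × ℕ => nodes x.1 x.2) := by
  refine flatMap (cons (cons id.left.left (const [])) (map (g := fun _ (r : Rule) => r.2.2)
    id.left.right id.right.right.right)) (map (below id.left.right) ?_)
  exact id.left.right.pair id.right

theorem polyTime_expand (d : ℕ) : PolyTime (fun x : ℕ × List Rule × List Node × List Node =>
    expand d x.1 x.2.1 x.2.2.1 x.2.2.2) := by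
  refine filter id.right.right.left (or (any id.left.right.right.right ?_)
    (any id.left.right.left (any id.left.left.right.right.right ?_)))
  · exact eq id.right id.left.right
  · refine and (eq id.right.left (cons id.left.right.left (const [])))
      (and (eq id.left.left.right.left id.left.right.right.right)
        (eq id.left.left.right.right (add id.right.right ?_)))
    exact (polyTime_weight d).comp (id.left.left.left.left.pair id.left.right.right.left)

/-- After the first step every intermediate list is a sublist of the list of nodes, whatever the
number of steps; this gives the bound needed for the fold. -/
theorem polyTime_reach (d : ℕ) :
    PolyTime (fun x : (ℕ × ℕ × ℕ) × Raw => reach d x.1.1 x.1.2.1 x.1.2.2 x.2) := by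
  have hn : PolyTime (fun x : (ℕ × ℕ × ℕ) × Raw => nodes x.2 x.1.2.1) :=
    polyTime_nodes.comp (id.right.pair id.left.right.left)
  have hz : PolyTime (fun x : (ℕ × ℕ × ℕ) × Raw => [([x.2.1], 0)]) :=
    cons ((cons id.right.left (const [])).pair (const 0)) (const [])
  obtain ⟨p, hp⟩ := hn.size_le
  obtain ⟨q, hq⟩ := hz.size_le
  refine foldl (g := fun y : ((ℕ × ℕ × ℕ) × Raw) × List Node × Unit =>
    expand d y.1.1.1 y.1.2.2 (nodes y.1.2 y.1.1.2.1) y.2.1) id.left.right.right.replicate_unit hz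
    ?_ (p + q) fun x l _ => ?_
  · exact (polyTime_expand d).comp (id.left.left.left.pair (id.left.right.right.pair
      ((hn.comp id.left).pair id.right.left)))
  · rw [Polynomial.eval_add]
    rcases List.eq_nil_or_concat l with rfl | ⟨l, a, rfl⟩
    · exact (hq x).trans (Nat.le_add_left _ _)
    · rw [List.concat_eq_append, List.foldl_append]
      exact (size_le_of_sublist List.filter_sublist).trans ((hp x).trans (Nat.le_add_right _ _))

/-- Here it matters that `d` is fixed: the recursion becomes a composition of `d` polynomial time
functions. -/
theorem polyTime_bound (d : ℕ) : PolyTime (ZeroSum.bound d) := by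
  induction d with
  | zero => exact const 1
  | succ d ih =>
    have h : PolyTime (fun n : ℕ => 2 * n + 1) := ((const 2).mul id).add (const 1)
    exact h.mul (ih.comp (id.mul h))

theorem polyTime_pathBound (d : ℕ) : PolyTime (CommGrammar.pathBound d) :=
  (id.mul id).add (id.mul ((polyTime_bound d).comp (id.mul id)))

/-- Whether the two grammars produce a common output by paths of length at most `L`. -/
def meets (d L : ℕ) (G H : Raw) : Bool :=
  (reach d (L + 1) (L * (L + 1) ^ d + 1) L G).any fun x =>
    (reach d (L + 1) (L * (L + 1) ^ d + 1) L H).any fun y =>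
      decide (x.1 = []) && (decide (y.1 = []) && decide (x.2 = y.2))

theorem polyTime_meets (d : ℕ) : PolyTime (fun x : ℕ × Raw × Raw => meets d x.1 x.2.1 x.2.2) := by
  have hM : PolyTime (fun x : ℕ × Raw × Raw => x.1 + 1) := id.left.add (const 1)
  have hx : PolyTime (fun x : ℕ × Raw × Raw => (x.1 + 1, x.1 * (x.1 + 1) ^ d + 1, x.1)) :=
    hM.pair (((id.left.mul (hM.pow d)).add (const 1)).pair id.left)
  refine any ((polyTime_reach d).comp (hx.pair id.right.left))
    (any ((polyTime_reach d).comp ((hx.comp id.left).pair id.left.right.right)) ?_)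
  exact and (eq id.left.right.left (const [])) (and (eq id.right.left (const []))
    (eq id.left.right.right id.right.right))

/-- Whether no common output is found. -/
def decideDisjoint (d : ℕ) (G H : Raw) : Bool :=
  !meets d (CommGrammar.pathBound d (G.2.length + H.2.length + 1)) G H

theorem polyTime_decideDisjoint (d : ℕ) :
    PolyTime (fun x : Raw × Raw => decideDisjoint d x.1 x.2) :=
  ((polyTime_meets d).comp (((polyTime_pathBound d).comp
    ((id.left.right.length.add id.right.right.length).add (const 1))).pair id)).not

/-- The algorithm, on the reversed input. -/
def algorithm {d : ℕ} (w : List (GrammarSymbol d)) : Bool :=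
  decideDisjoint d (parse w).2.2.1 (parse w).2.2.2

theorem polyTime_algorithm (d : ℕ) : PolyTime (algorithm (d := d)) :=
  (polyTime_decideDisjoint d).comp (polyTime_parse d).right.right

end RawGrammar

/-! ### Correctness of the algorithm -/

namespace RawGrammar

open CommGrammar GrammarSymbol Multigraph

variable {d n : ℕ}

/-- The binary notation for a state. -/
def encodeState (s : Fin n) : List Bool := Computability.encodeNat s

theorem encodeState_injective : Function.Injective (encodeState (n := n)) :=
  (Function.LeftInverse.injective Computability.decode_encodeNat).comp Fin.val_injective

/-- A transition as it is seen by the algorithm. -/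
def ofTransition (τ : CommTransition (Fin d) (Fin n)) : Rule :=
  (encodeState τ.source, (τ.out.sort (· ≤ ·)).map Fin.val,
    (τ.target.sort (· ≤ ·)).map encodeState)

/-- A grammar as it is seen by the algorithm. -/
def ofInput (G : RegularGrammarInput d) : Raw :=
  (encodeState G.grammar.init, G.rules.map ofTransition)

/-! ### Correctness of the parser -/

/-- The effect of reading a word from right to left. -/
def readWord (w : List (GrammarSymbol d)) (m : Memory) : Memory :=
  w.foldr (fun x m => read x.toPair m) m

theorem readWord_append (w w' : List (GrammarSymbol d)) (m : Memory) :
    readWord (w ++ w') m = readWord w (readWord w' m) := List.foldr_append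

theorem readWord_cons (x : GrammarSymbol d) (w : List (GrammarSymbol d)) (m : Memory) :
    readWord (x :: w) m = read x.toPair (readWord w m) := rfl

theorem readWord_bits (l b : List Bool) (r : List ℕ × List (List Bool))
    (m : List Rule × Raw × Raw) :
    readWord (d := d) (l.map bit) ((b, r), m) = ((l ++ b, r), m) := by
  induction l with
  | nil => rfl
  | cons c l ih =>
    rw [List.map_cons, readWord_cons, ih]
    cases c <;> rfl

theorem readWord_letters (l : List (Fin d)) (b : List Bool) (k : List ℕ) (t : List (List Bool))
    (m : List Rule × Raw × Raw) :
    readWord (l.map letter) ((b, k, t), m) = ((b, l.map Fin.val ++ k, t), m) := by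
  induction l with
  | nil => rfl
  | cons a l ih => rw [List.map_cons, readWord_cons, ih]; rfl

/-- From right to left, the bits of a state come before its `target` symbol, which moves them to the
list of targets and clears the buffer for the next state. -/
theorem readWord_targets (l : List (Fin n)) (k : List ℕ) (t : List (List Bool))
    (m : List Rule × Raw × Raw) :
    readWord (d := d) (l.flatMap fun s => target :: writeState s) (([], k, t), m) =
      (([], k, l.map encodeState ++ t), m) := by
  induction l with
  | nil => rfl
  | cons s l ih =>
    rw [List.flatMap_cons, readWord_append, ih, readWord_cons, writeState, readWord_bits,
      List.append_nil]
    rfl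

theorem readWord_transition (τ : CommTransition (Fin d) (Fin n)) (rules : List Rule)
    (m : Raw × Raw) : readWord (writeTransition τ) (emptyRule, rules, m) =
      (emptyRule, ofTransition τ :: rules, m) := by
  rw [writeTransition, readWord_append, emptyRule, readWord_targets, List.cons_append,
    readWord_cons, readWord_append, readWord_letters, writeState, readWord_bits, List.append_nil,
    List.append_nil, List.append_nil]
  rfl

theorem readWord_rules (l : List (CommTransition (Fin d) (Fin n))) (m : Raw × Raw) :
    readWord (l.flatMap writeTransition) (emptyRule, [], m) =
      (emptyRule, l.map ofTransition, m) := by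
  induction l with
  | nil => rfl
  | cons τ l ih => rw [List.flatMap_cons, readWord_append, ih, readWord_transition, List.map_cons]

/-- A completed grammar is put in front of the previous one, so a pair read from the right ends up
in its original order. -/
theorem readWord_grammar (G : RegularGrammarInput d) (m : Raw × Raw) :
    readWord (writeGrammar G) (emptyRule, [], m) = (emptyRule, [], ofInput G, m.1) := by
  rw [writeGrammar, readWord_append, readWord_rules, readWord_cons, writeState, emptyRule,
    readWord_bits, List.append_nil]
  rfl

theorem parse_writePair (P : RegularGrammarInput d × RegularGrammarInput d) :
    parse (writePair P).reverse = (emptyRule, [], ofInput P.1, ofInput P.2) := by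
  have h : parse (writePair P).reverse =
      readWord (writePair P) (emptyRule, [], ([], []), ([], [])) := List.foldl_reverse
  rw [h, writePair, readWord_append, readWord_grammar, readWord_grammar]

/-! ### Outputs as numbers in base `M` -/

/-- The value of a multiset of digits. -/
def value (M : ℕ) (v : Multiset (Fin d)) : ℕ := (v.map fun a => M ^ (a : ℕ)).sum

theorem value_add (M : ℕ) (v w : Multiset (Fin d)) : value M (v + w) = value M v + value M w := by
  simp [value]

theorem letterWeight_eq (M : ℕ) {a : ℕ} (h : a < d) : letterWeight M d a = M ^ a := by
  induction d with
  | zero => omega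
  | succ d ih =>
    rw [letterWeight]
    by_cases h' : a = d
    · simp [h']
    · simpa [h'] using ih (by omega)

theorem weight_map_val (M : ℕ) (l : List (Fin d)) :
    weight d M (l.map Fin.val) = value M (.ofList l) := by
  induction l with
  | nil => rfl
  | cons a l ih =>
    rw [List.map_cons, weight, List.foldr_cons, ← weight, ih, letterWeight_eq M (Fin.isLt _)]
    simp [value]

theorem weight_ofTransition (M : ℕ) (τ : CommTransition (Fin d) (Fin n)) :
    weight d M (ofTransition τ).2.1 = value M τ.out := by
  rw [ofTransition, weight_map_val, Multiset.sort_eq]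

theorem value_le {M : ℕ} (hM : 0 < M) (v : Multiset (Fin d)) : value M v ≤ v.card * M ^ d := by
  have h := Multiset.sum_le_card_nsmul (v.map fun a : Fin d => M ^ (a : ℕ)) (M ^ d) fun x hx => by
    obtain ⟨a, -, rfl⟩ := Multiset.mem_map.1 hx
    exact Nat.pow_le_pow_right hM a.2.le
  simpa [value] using h

theorem value_eq_sum (M : ℕ) (v : Multiset (Fin d)) :
    value M v = ∑ i : Fin d, v.count i * M ^ (i : ℕ) := by
  induction v using Multiset.induction_on with
  | empty => simp [value]
  | cons a v ih =>
    have h : value M (a ::ₘ v) = M ^ (a : ℕ) + value M v := by simp [value]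
    simp [h, ih, Multiset.count_cons, add_mul, Finset.sum_add_distrib, add_comm]

/-- Uniqueness of digits in base `M`: the residue modulo `M` determines the lowest one, and the
quotient the others. -/
theorem eq_of_sum_mul_pow_eq {M : ℕ} : ∀ {d : ℕ} {f g : Fin d → ℕ}, (∀ i, f i < M) →
    (∀ i, g i < M) → ∑ i : Fin d, f i * M ^ (i : ℕ) = ∑ i : Fin d, g i * M ^ (i : ℕ) → f = g
  | 0, _, _, _, _, _ => Subsingleton.elim _ _
  | d + 1, f, g, hf, hg, h => by
    have key : ∀ f : Fin (d + 1) → ℕ, ∑ i : Fin (d + 1), f i * M ^ (i : ℕ) =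
        f 0 + M * ∑ i : Fin d, f i.succ * M ^ (i : ℕ) := fun f => by
      rw [Fin.sum_univ_succ, Finset.mul_sum]
      simp [pow_succ, mul_comm, mul_left_comm]
    rw [key, key] at h
    have hM : 0 < M := (Nat.zero_le _).trans_lt (hf 0)
    have h₁ : f 0 = g 0 := by
      have := congrArg (· % M) h
      simpa [Nat.add_mul_mod_self_left, Nat.mod_eq_of_lt (hf 0), Nat.mod_eq_of_lt (hg 0)] using this
    rw [h₁] at h
    have h₂ := eq_of_sum_mul_pow_eq (fun i : Fin d => hf i.succ) (fun i => hg i.succ)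
      (Nat.eq_of_mul_eq_mul_left hM (Nat.add_left_cancel h))
    funext i
    refine Fin.cases h₁ (fun i => congrFun h₂ i) i

/-- With fewer than `M` letters in total, every multiplicity is a valid digit. -/
theorem value_injective {M : ℕ} {v w : Multiset (Fin d)} (hv : v.card < M) (hw : w.card < M)
    (h : value M v = value M w) : v = w := by
  rw [value_eq_sum, value_eq_sum] at h
  ext i
  exact congrFun (eq_of_sum_mul_pow_eq (fun i => (v.count_le_card i).trans_lt hv)
    (fun i => (w.count_le_card i).trans_lt hw) h) i

theorem card_outOf_le {A S : Type} {G : CommGrammar A S} {p : List (CommTransition A S)}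
    (hp : ∀ τ ∈ p, τ ∈ G.transitions) : (outOf (.ofList p)).card ≤ p.length := by
  induction p with
  | nil => simp [outOf]
  | cons τ p ih =>
    have h₁ := G.card_out_le τ (hp τ (by simp))
    have h₂ := ih fun τ hτ => hp τ (by simp [hτ])
    simp only [outOf, Multiset.map_coe, Multiset.sum_coe, List.map_cons, List.sum_cons,
      Multiset.card_add, List.length_cons] at h₂ ⊢
    omega

/-! ### Correctness of the search -/

/-- The list of states in which a path ends. -/
def encodeEnd (v : Option (Fin n)) : List (List Bool) := v.toList.map encodeState

theorem encodeEnd_injective : Function.Injective (encodeEnd (n := n)) := by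
  rintro (_ | s) (_ | t) h <;> simp [encodeEnd] at h ⊢
  exact encodeState_injective h

theorem ofTransition_targets {τ : CommTransition (Fin d) (Fin n)} (h : τ.target.card ≤ 1) :
    (ofTransition τ).2.2 = encodeEnd (nextState τ) := by
  rcases target_eq_of_card_le h with ⟨h₁, h₂⟩ | ⟨s, h₁, h₂⟩ <;>
    simp [ofTransition, encodeEnd, h₁, h₂]

theorem mem_nodes {G : Raw} {W : ℕ} {y : Node} :
    y ∈ nodes G W ↔ (y.1 = [G.1] ∨ ∃ r ∈ G.2, r.2.2 = y.1) ∧ y.2 < W := by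
  obtain ⟨t, i⟩ := y
  simp only [nodes, List.mem_flatMap, List.mem_cons, List.mem_map, StackMachine.mem_below,
    Prod.mk.injEq]
  constructor
  · rintro ⟨u, hu, j, hj, rfl, rfl⟩
    exact ⟨hu, hj⟩
  · rintro ⟨hu, hj⟩
    exact ⟨t, hu, i, hj, rfl, rfl⟩

theorem mem_expand {M : ℕ} {rules : List Rule} {N R : List Node} {y : Node} :
    y ∈ expand d M rules N R ↔ y ∈ N ∧ (y ∈ R ∨ ∃ r ∈ rules, ∃ x ∈ R, x.1 = [r.1] ∧
      y.1 = r.2.2 ∧ y.2 = x.2 + weight d M r.2.1) := by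
  simp [expand]

theorem reach_succ (M W k : ℕ) (G : Raw) :
    reach d M W (k + 1) G = expand d M G.2 (nodes G W) (reach d M W k G) := by
  rw [reach, List.replicate_succ', List.foldl_append]
  rfl

theorem isPath_concat {A S : Type} {u v : Option S} {p : List (CommTransition A S)}
    {τ : CommTransition A S} :
    IsPath u (p ++ [τ]) v ↔ IsPath u p (some τ.source) ∧ nextState τ = v := by
  rw [IsPath, walk_append]
  simp only [Walk]
  constructor
  · rintro ⟨w, h, rfl, h'⟩
    exact ⟨h, h'⟩
  · rintro ⟨h, h'⟩
    exact ⟨_, h, rfl, h'⟩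

theorem outOf_concat {A S : Type} (p : List (CommTransition A S)) (τ : CommTransition A S) :
    outOf (.ofList (p ++ [τ])) = outOf (.ofList p) + τ.out := by
  simp [outOf]

variable {G H : RegularGrammarInput d} {M W k L : ℕ}

/-- Soundness: a node that is new in a step extends a path by one transition, and an old one keeps
its path. The bound `W` plays no role in this direction. -/
theorem exists_path_of_mem_reach {x : Node} (h : x ∈ reach d M W k (ofInput G)) :
    ∃ p v, IsPath (some G.grammar.init) p v ∧ (∀ τ ∈ p, τ ∈ G.grammar.transitions) ∧
      p.length ≤ k ∧ x = (encodeEnd v, value M (outOf (.ofList p))) := by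
  induction k generalizing x with
  | zero =>
    refine ⟨[], some G.grammar.init, rfl, by simp, le_rfl, ?_⟩
    simpa [reach, encodeEnd, ofInput, outOf, value] using h
  | succ k ih =>
    rw [reach_succ, mem_expand] at h
    obtain ⟨-, h | ⟨r, hr, y, hy, h₁, h₂, h₃⟩⟩ := h
    · obtain ⟨p, v, h₁, h₂, h₃, h₄⟩ := ih h
      exact ⟨p, v, h₁, h₂, by omega, h₄⟩
    · obtain ⟨p, v, h₄, h₅, h₆, rfl⟩ := ih hy
      obtain ⟨τ, hτ, rfl⟩ := List.mem_map.1 hr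
      rw [G.mem_rules] at hτ
      have hv : v = some τ.source := encodeEnd_injective h₁
      subst hv
      refine ⟨p ++ [τ], nextState τ, isPath_concat.2 ⟨h₄, rfl⟩, ?_, by simpa using h₆, ?_⟩
      · simp only [List.mem_append, List.mem_singleton]
        rintro σ (hσ | rfl)
        exacts [h₅ σ hσ, hτ]
      · rw [outOf_concat, value_add, ← weight_ofTransition, ← h₃,
          ← ofTransition_targets (G.regular τ hτ), ← h₂]

theorem mem_reach_of_isPath {p : List (CommTransition (Fin d) (Fin G.n))} {v : Option (Fin G.n)}
    (h : IsPath (some G.grammar.init) p v) (hp : ∀ τ ∈ p, τ ∈ G.grammar.transitions)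
    (hk : p.length ≤ k) (hW : value M (outOf (.ofList p)) < W) :
    (encodeEnd v, value M (outOf (.ofList p))) ∈ reach d M W k (ofInput G) := by
  induction k generalizing p v with
  | zero =>
    obtain rfl : p = [] := by simpa using hk
    obtain rfl : some G.grammar.init = v := h
    simp [reach, encodeEnd, ofInput, outOf, value]
  | succ k ih =>
    rw [reach_succ, mem_expand, mem_nodes]
    rcases List.eq_nil_or_concat p with rfl | ⟨p, τ, rfl⟩
    · obtain rfl : some G.grammar.init = v := h
      exact ⟨⟨.inl rfl, hW⟩, .inl (ih rfl (by simp) (by simp) hW)⟩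
    · rw [List.concat_eq_append] at *
      obtain ⟨h₁, rfl⟩ := isPath_concat.1 h
      have hτ := hp τ (by simp)
      have hr : ofTransition τ ∈ (ofInput G).2 := List.mem_map_of_mem ((G.mem_rules τ).2 hτ)
      have ht := ofTransition_targets (G.regular τ hτ)
      rw [outOf_concat, value_add] at hW ⊢
      -- Values only increase along a path, so the shorter path stays below `W` too.
      refine ⟨⟨.inr ⟨_, hr, ht⟩, hW⟩, .inr ⟨_, hr, _, ih h₁ (fun σ hσ => hp σ (by simp [hσ]))
        (by simpa using hk) (by omega), rfl, ht.symm, ?_⟩⟩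
      rw [weight_ofTransition]

/-- Paths of length at most `L` produce at most `L` letters. Hence base L + 1 separates their
outputs, and all their values are at most L(L + 1)^d, so the counter does not cut them off. -/
theorem meets_iff : meets d L (ofInput G) (ofInput H) = true ↔
    ∃ p q, IsPath (some G.grammar.init) p none ∧ (∀ τ ∈ p, τ ∈ G.grammar.transitions) ∧
      IsPath (some H.grammar.init) q none ∧ (∀ τ ∈ q, τ ∈ H.grammar.transitions) ∧
      p.length ≤ L ∧ q.length ≤ L ∧ outOf (.ofList p) = outOf (.ofList q) := by
  simp only [meets, List.any_eq_true, Bool.and_eq_true, decide_eq_true_eq]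
  constructor
  · rintro ⟨x, hx, y, hy, h₁, h₂, h₃⟩
    obtain ⟨p, v, hp₁, hp₂, hp₃, rfl⟩ := exists_path_of_mem_reach hx
    obtain ⟨q, w, hq₁, hq₂, hq₃, rfl⟩ := exists_path_of_mem_reach hy
    obtain rfl : v = none := encodeEnd_injective h₁
    obtain rfl : w = none := encodeEnd_injective h₂
    exact ⟨p, q, hp₁, hp₂, hq₁, hq₂, hp₃, hq₃, value_injective
      ((card_outOf_le hp₂).trans_lt (by omega)) ((card_outOf_le hq₂).trans_lt (by omega)) h₃⟩
  · rintro ⟨p, q, hp₁, hp₂, hq₁, hq₂, hp₃, hq₃, h⟩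
    have hW : value (L + 1) (outOf (.ofList p)) < L * (L + 1) ^ d + 1 :=
      Nat.lt_succ_of_le ((value_le (by omega) _).trans
        (Nat.mul_le_mul_right _ ((card_outOf_le hp₂).trans hp₃)))
    exact ⟨_, mem_reach_of_isPath hp₁ hp₂ hp₃ hW, _, mem_reach_of_isPath hq₁ hq₂ hq₃ (h ▸ hW),
      rfl, rfl, congrArg (value (L + 1)) h⟩

/-- The number of states is not written in the input. It is controlled by the number of listed
transitions because every state is the source of one, which justifies the choice of `N` in
`decideDisjoint`. -/
theorem length_rules_ge (G : RegularGrammarInput d) : G.n ≤ G.rules.length := by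
  have h : ∀ s, s ∈ G.rules.map CommTransition.source := fun s => by
    obtain ⟨τ, hτ, rfl⟩ := G.grammar.exists_source s
    exact List.mem_map_of_mem ((G.mem_rules τ).2 hτ)
  have h₁ := List.toFinset_card_le (G.rules.map CommTransition.source)
  rw [Finset.eq_univ_of_forall fun s => List.mem_toFinset.2 (h s)] at h₁
  simpa using h₁

theorem algorithm_eq_true_iff (P : RegularGrammarInput d × RegularGrammarInput d) :
    algorithm (writePair P).reverse = true ↔
      P.1.grammar.outputs ∩ P.2.grammar.outputs = ∅ := by
  obtain ⟨G, H⟩ := P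
  rw [algorithm, parse_writePair, decideDisjoint, Bool.not_eq_true', ← Bool.not_eq_true,
    meets_iff, ← Set.not_nonempty_iff_eq_empty, not_iff_not]
  constructor
  · rintro ⟨p, q, hp₁, hp₂, hq₁, hq₂, -, -, h⟩
    exact ⟨_, hp₁.mem_outputs G.regular hp₂, h ▸ hq₁.mem_outputs H.regular hq₂⟩
  · have hG := length_rules_ge G
    have hH := length_rules_ge H
    refine exists_short_paths G.regular H.regular ?_ ?_ <;>
    · simp only [ofInput, List.length_map]
      omega

end RawGrammar

theorem mainTheorem4 (d : ℕ) :
    DecidableInPolyTime (GrammarSymbol.writePair (d := d))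
      (fun P : RegularGrammarInput d × RegularGrammarInput d =>
        P.1.grammar.outputs ∩ P.2.grammar.outputs = ∅) := by
  exact (RawGrammar.polyTime_algorithm d).decidableInPolyTime RawGrammar.algorithm_eq_true_iff
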